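/- Let $\mathbb F$ be the field of real or complex scalars and let $0<p\le 1$. Let $\ell_p$ be the space of scalar sequences with the quasi-norm $\|x\|=(\sum_n|x(n)|^p)^{1/p}$, and let $(\mathbf e_n)_{n=1}^\infty$ be its unit vectors. For a sequence $\delta=(d_n)_{n=1}^\infty$ of integers $d_n\ge 2$ put $\sigma(k)=2+\sum_{j=1}^{k-1}d_j$ and \[ \mathbf x_k=\mathbf e_k-d_k^{-1/p}\sum_{j=\sigma(k)}^{\sigma(k+1)-1}\mathbf e_j,\qquad k\ge 1, \] and let $\mathbb X_p(\delta)$ be the closed linear span of $\{\mathbf x_k: k\ge 1\}$ in $\ell_p$. A *basis* $\mathcal B=(\mathbf y_n)_{n=1}^\infty$ of a quasi-Banach space $\mathbb Y$ is a semi-normalized fundamental $M$-bounded Markushevich basis: the closed linear span of the $\mathbf y_n$ is $\mathbb Y$, $0<\inf_n\|\mathbf y_n\|\le\sup_n\|\mathbf y_n\|<\infty$, and there are biorthogonal functionals $\mathbf y_n^*\in\mathbb Y^*$ that separate the points of $\mathbb Y$, with $\sup_n\|\mathbf y_n^*\|<\infty$. For finite $A\subseteq\mathbb N$ put $S_A(f)=\sum_{n\in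 A}\mathbf y_n^*(f)\,\mathbf y_n$. The set $A$ is a greedy set of $f$ if $|\mathbf y_n^*(f)|\ge|\mathbf y_k^*(f)|$ for all $n\in A$, $k\notin A$. The basis is *almost greedy* if there is a constant $C$ such that $\|f-S_A(f)\|\le C\|f-S_D(f)\|$ for every $f\in\mathbb Y$, every finite greedy set $A$ of $f$ and every $D\subseteq \mathbb N$ with $|D|=|A|$. Its conditionality constants are $k_m[\mathcal B,\mathbb Y]=\sup_{|A|\le m}\|S_A\|$. Two bases $(\mathbf y_j)$ and $(\mathbf z_j)$ of quasi-Banach spaces $\mathbb Y$ and $\mathbb Z$ are *permutatively equivalent* if there are a bijection $\pi$ of $\mathbb N$ and an isomorphism $T$ of $\mathbb Y$ onto $\mathbb Z$ with $T(\mathbf y_{\pi(j)})=\mathbf z_j$ for all $j$. Let $\mathbb Y$ be either $\ell_p$ or $\mathbb X_p(\delta)$, where $\delta$ is any sequence of integers $\ge 2$. Then there is a set $\mathfrak B$ of almost greedy bases of $\mathbb Y$, of the cardinality of the continuum, such that no two different members of $\mathfrak B$ are permutatively equivalent. Moreover, $\mathfrak B$ can be chosen so that for every $0<a\le 1/p$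 it contains a basis $\mathcal B$ for which there are constants $0<c\le C<\infty$ with \[ c\,(\log m)^a\le k_m[\mathcal B,\mathbb Y]\le C\,(\log m)^a,\qquad m\ge 2. \] -/

import Mathlib

/-! ### Quasi-normed spaces

The space `Y` below is a vector space over `𝕜` (the real or complex field) and its quasi-norm is
given by the `Norm` instance. All topological notions are spelled out through the quasi-norm, since
for `p < 1` the spaces of sequences `ℓ_p` are not normed spaces. -/

/-- A subspace `V` is closed for the quasi-norm: it contains the limits of its elements. -/
def IsQuasiNormClosed {𝕜 Y : Type*} [RCLike 𝕜] [AddCommGroup Y] [Module 𝕜 Y] [Norm Y]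
    (V : Submodule 𝕜 Y) : Prop :=
  ∀ x : Y, (∀ ε : ℝ, 0 < ε → ∃ y ∈ V, ‖x - y‖ < ε) → x ∈ V

/-- `[s]`, the smallest closed subspace containing the set `s`. -/
def closedSpan (𝕜 : Type*) {Y : Type*} [RCLike 𝕜] [AddCommGroup Y] [Module 𝕜 Y] [Norm Y]
    (s : Set Y) : Submodule 𝕜 Y :=
  sInf {V : Submodule 𝕜 Y | s ⊆ (V : Set Y) ∧ IsQuasiNormClosed V}

/-- A basis of `Y`: a semi-normalized, fundamental, `M`-bounded Markushevich basis `(y_n)` together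
with its biorthogonal functionals `(y_n^*)`. -/
structure MBasis (𝕜 Y : Type*) [RCLike 𝕜] [AddCommGroup Y] [Module 𝕜 Y] [Norm Y] where
  /-- the vectors `y_n` -/
  vec : ℕ → Y
  /-- the coordinate functionals `y_n^*` -/
  coord : ℕ → Y →ₗ[𝕜] 𝕜
  biorthogonal : ∀ m n : ℕ, coord m (vec n) = if m = n then 1 else 0
  fundamental : closedSpan 𝕜 (Set.range vec) = ⊤
  total : ∀ f : Y, (∀ n : ℕ, coord n f = 0) → f = 0
  norm_vec_lower : ∃ c : ℝ, 0 < c ∧ ∀ n : ℕ, c ≤ ‖vec n‖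
  norm_vec_upper : ∃ C : ℝ, ∀ n : ℕ, ‖vec n‖ ≤ C
  norm_coord : ∃ C : ℝ, ∀ (n : ℕ) (f : Y), ‖coord n f‖ ≤ C * ‖f‖

namespace MBasis

variable {𝕜 Y Z : Type*} [RCLike 𝕜] [AddCommGroup Y] [Module 𝕜 Y] [Norm Y]
  [AddCommGroup Z] [Module 𝕜 Z] [Norm Z]

/-- The coordinate projection `S_A(f) = ∑_{n ∈ A} y_n^*(f) y_n`. -/
def proj (B : MBasis 𝕜 Y) (A : Finset ℕ) (f : Y) : Y :=
  ∑ n ∈ A, B.coord n f • B.vec n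

/-- `A` is a greedy set of `f`: `|y_n^*(f)| ≥ |y_k^*(f)|` whenever `n ∈ A` and `k ∉ A`. Then
`S_A(f)` is a greedy approximation `G_m(f)` of `f`, with `m = |A|`. -/
def IsGreedySet (B : MBasis 𝕜 Y) (f : Y) (A : Finset ℕ) : Prop :=
  ∀ n ∈ A, ∀ k ∉ A, ‖B.coord k f‖ ≤ ‖B.coord n f‖

/-- Almost greedy: `‖f - G_m(f)‖ ≤ C ‖f - S_D(f)‖` for all `f`, all `m`, all the choices of the
greedy approximation `G_m(f)`, and all `D` with `|D| = m`. -/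
def IsAlmostGreedy (B : MBasis 𝕜 Y) : Prop :=
  ∃ C : ℝ, ∀ (f : Y) (A D : Finset ℕ), B.IsGreedySet f A → D.card = A.card →
    ‖f - B.proj A f‖ ≤ C * ‖f - B.proj D f‖

/-- Permutative equivalence: for some bijection `π` of `ℕ`, the linear map given by
`y_{π(j)} ↦ z_j` is an isomorphism of quasi-normed spaces (linear, bijective, bounded, with bounded
inverse). -/
def PermEquivalent (B : MBasis 𝕜 Y) (B' : MBasis 𝕜 Z) : Prop :=
  ∃ (π : Equiv.Perm ℕ) (T : Y ≃ₗ[𝕜] Z),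
    (∃ C : ℝ, ∀ f : Y, ‖T f‖ ≤ C * ‖f‖ ∧ ‖f‖ ≤ C * ‖T f‖) ∧
    ∀ j : ℕ, T (B.vec (π j)) = B'.vec j

/-- The conditionality constant `k_m = sup {‖S_A‖ : |A| ≤ m}`, where `‖S_A‖` is the operator
quasi-norm. It is written as the least `C` such that `‖S_A f‖ ≤ C ‖f‖` for all `f` and all `A` with
`|A| ≤ m`; such constants `C` exist for every basis of a quasi-normed space. -/
noncomputable def conditionalityConst (B : MBasis 𝕜 Y) (m : ℕ) : ℝ :=
  sInf {C : ℝ | 0 ≤ C ∧ ∀ A : Finset ℕ, A.card ≤ m → ∀ f : Y, ‖B.proj A f‖ ≤ C * ‖f‖}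

end MBasis

/-! ### The spaces `ℓ_p` and `𝕏_p(δ)`

Sequences are indexed by `ℕ = {0, 1, 2, …}`; the coordinate `k` here is the coordinate `k + 1` when
sequences are indexed from `1`. -/

/-- The space `ℓ_p` of scalar sequences, with its quasi-norm `‖x‖ = (∑ |x(n)|^p)^(1/p)`. -/
abbrev EllP (𝕜 : Type*) [RCLike 𝕜] (p : ℝ) : Type _ :=
  lp (fun _ : ℕ => 𝕜) (ENNReal.ofReal p)

/-- `σ(k) = 1 + d_0 + ⋯ + d_{k-1}` (with indices from `0`). -/
def lindenstraussSigma (d : ℕ → ℕ) (k : ℕ) : ℕ :=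
  1 + ∑ i ∈ Finset.range k, d i

/-- The unit vector `e_j` of `ℓ_p`. -/
noncomputable def ellpUnit (𝕜 : Type*) [RCLike 𝕜] (p : ℝ) (j : ℕ) : EllP 𝕜 p :=
  lp.single (ENNReal.ofReal p) j (1 : 𝕜)

/-- The vector `x_k = e_k - d_k^{-1/p} ∑_{σ(k) ≤ j < σ(k+1)} e_j` of `ℓ_p`. -/
noncomputable def lindenstraussVec (𝕜 : Type*) [RCLike 𝕜] (p : ℝ) (d : ℕ → ℕ) (k : ℕ) :
    EllP 𝕜 p :=
  ellpUnit 𝕜 p k -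
    (((d k : ℝ) ^ (-(1 / p)) : ℝ) : 𝕜) •
      ∑ j ∈ Finset.Ico (lindenstraussSigma d k) (lindenstraussSigma d (k + 1)), ellpUnit 𝕜 p j

/-- The space `𝕏_p(δ) = [x_k : k ∈ ℕ] ⊆ ℓ_p` for the sequence `δ = (d_k)`. -/
noncomputable def LindenstraussSpace (𝕜 : Type*) [RCLike 𝕜] (p : ℝ) (d : ℕ → ℕ) :
    Submodule 𝕜 (EllP 𝕜 p) :=
  closedSpan 𝕜 (Set.range (lindenstraussVec 𝕜 p d))

/-- `𝕏_p(δ)` carries the quasi-norm of `ℓ_p`. -/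
noncomputable instance LindenstraussSpace.instNorm (𝕜 : Type*) [RCLike 𝕜] (p : ℝ) (d : ℕ → ℕ) :
    Norm (LindenstraussSpace 𝕜 p d) :=
  ⟨fun x => ‖(x : EllP 𝕜 p)‖⟩

/-! Everything happens in weighted forests on `ℕ`. A node `j` has a parent `par j` and an edge
weight `w j` of mass `|w j|^p`. The masses of the edges from a node to its children sum to at most
one, and each is at most one half. The vectors `v k = e_k - ∑ w c • e_c`, over the children `c` of
`k`, satisfy `∑ a k • v k = differ a`, so the quasi-norm is read off from the differences `a j - w j
* a (par j)`.

Such a system is always almost greedy (`IsForest.pSum_differ_greedy_le`): the mass `∑ |a k|^p` over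
a finite greedy set flows down the edges, and what leaves the set is at most twice the `p`-th power
of the quasi-norm.

The conditionality constants depend on how fast the forest branches. If edges leaving depth `i` have
mass at most `2^(-e i)`, a coefficient is a sum of contributions from its ancestors. Over `m` nodes,
the ancestors `l` generations up contribute at most `min 1 (m * 2^(-levelSum e l))` times the `p`-th
power of the quasi-norm (`IsForest.sum_coord_le`). Conversely, in a finite tree where nodes of depth
`i` have exactly `2^(e i)` children of equal mass, some vector of norm one has total mass one on
every level, and projecting it on the even levels destroys the cancellation
(`GlueData.exists_large_projection`). Hence `k_m^p` is of the order of the height of a tree with `m`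
nodes. Taking `levelSum e l` of order `l^q` with `q = 1/(a*p) ≥ 1` makes this height of order `(log
m)^(a*p)`.

In `ℓ_p` a disjoint union of such finite trees works, because within finite trees the vectors `v k`
span the unit vectors. The generators of `𝕏_p(δ)` already come from one infinite tree. To prescribe
its branching, only the levels `levelSum e l` are kept: selected nodes are attached to their nearest
selected ancestors, which gives an equivalent quasi-norm (`IsRootedTree.pSum_mix`). Chains of
unselected nodes are finite, so these nodes split off as unit vectors (`span_differ_eq`), and their
infinite set of indices is then arranged in the finite trees that give the lower bound.

The growth order of `k_m` is invariant under permutative equivalence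
(`MBasis.PermEquivalent.growth_le`), so one basis for each `a` in `(0, 1/p]` gives the continuum. -/

open scoped ENNReal

/-! ### Weighted forests and conservation of mass. -/

/-- The `p`-th power of the `ℓ_p` quasi-norm, as an extended nonnegative real. -/
noncomputable def pSum {𝕜 : Type*} [RCLike 𝕜] (p : ℝ) (f : ℕ → 𝕜) : ℝ≥0∞ :=
  ∑' j, ‖f j‖ₑ ^ p

/-- The vector with coordinates `a j - w j * a (par j)`. -/
noncomputable def differ (𝕜 : Type*) [RCLike 𝕜] (par : ℕ → ℕ) (w : ℕ → ℝ) :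
    (ℕ → 𝕜) →ₗ[𝕜] (ℕ → 𝕜) where
  toFun a j := a j - (w j : 𝕜) * a (par j)
  map_add' a b := by ext j; simp only [Pi.add_apply]; ring
  map_smul' c a := by ext j; simp only [Pi.smul_apply, smul_eq_mul, RingHom.id_apply]; ring

/-- The `p`-th power of a weight. -/
noncomputable def edgeMass (p : ℝ) (w : ℕ → ℝ) (j : ℕ) : ℝ≥0∞ := ‖w j‖ₑ ^ p

/-- A weighted forest on `ℕ`: the `p`-th powers of the weights of the children of a node sum up to
at most one, and none of them exceeds one half. -/
structure IsForest (p : ℝ) (par : ℕ → ℕ) (w : ℕ → ℝ) : Prop where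
  mass_le_half : ∀ j, edgeMass p w j ≤ 2⁻¹
  sum_children_le : ∀ k, ∑' j, (if par j = k then edgeMass p w j else 0) ≤ 1

section Basic

variable {𝕜 : Type*} [RCLike 𝕜] {p : ℝ} {par : ℕ → ℕ} {w : ℕ → ℝ}

lemma enorm_rpow_add_le (hp0 : 0 < p) (hp1 : p ≤ 1) (x y : 𝕜) :
    ‖x + y‖ₑ ^ p ≤ ‖x‖ₑ ^ p + ‖y‖ₑ ^ p :=
  (ENNReal.rpow_le_rpow (enorm_add_le x y) hp0.le).trans
    (ENNReal.rpow_add_le_add_rpow _ _ hp0.le hp1)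

lemma enorm_rpow_sub_le (hp0 : 0 < p) (hp1 : p ≤ 1) (x y : 𝕜) :
    ‖x - y‖ₑ ^ p ≤ ‖x‖ₑ ^ p + ‖y‖ₑ ^ p := by
  have := enorm_rpow_add_le hp0 hp1 x (-y)
  rwa [← sub_eq_add_neg, enorm_neg] at this

lemma enorm_rpow_ofReal_mul (hp0 : 0 < p) (j : ℕ) (x : 𝕜) :
    ‖(w j : 𝕜) * x‖ₑ ^ p = edgeMass p w j * ‖x‖ₑ ^ p := by
  rw [enorm_mul, ENNReal.mul_rpow_of_nonneg _ _ hp0.le, edgeMass]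
  congr 2
  rw [← ofReal_norm, ← ofReal_norm, RCLike.norm_ofReal, Real.norm_eq_abs]

lemma pSum_add_le (hp0 : 0 < p) (hp1 : p ≤ 1) (f g : ℕ → 𝕜) :
    pSum p (f + g) ≤ pSum p f + pSum p g := by
  rw [pSum, pSum, pSum, ← ENNReal.tsum_add]
  exact ENNReal.tsum_le_tsum fun j => enorm_rpow_add_le hp0 hp1 _ _

lemma pSum_sub_le (hp0 : 0 < p) (hp1 : p ≤ 1) (f g : ℕ → 𝕜) :
    pSum p (f - g) ≤ pSum p f + pSum p g := by
  rw [pSum, pSum, pSum, ← ENNReal.tsum_add]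
  exact ENNReal.tsum_le_tsum fun j => enorm_rpow_sub_le hp0 hp1 _ _

lemma eq_zero_of_pSum_eq_zero (hp0 : 0 < p) {f : ℕ → 𝕜} (h : pSum p f = 0) : f = 0 := by
  ext j
  have := ENNReal.tsum_eq_zero.1 h j
  rw [ENNReal.rpow_eq_zero_iff] at this
  rcases this with h | h
  · simpa using h.1
  · linarith [h.2]

@[simp] lemma differ_apply (a : ℕ → 𝕜) (j : ℕ) :
    differ 𝕜 par w a j = a j - (w j : 𝕜) * a (par j) := rfl

lemma edgeMass_eq_zero (hp0 : 0 < p) {j : ℕ} (h : w j = 0) : edgeMass p w j = 0 := by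
  simp [edgeMass, h, hp0]

lemma edgeMass_ne_zero {j : ℕ} (hp0 : 0 < p) (h : edgeMass p w j ≠ 0) : w j ≠ 0 :=
  fun h' => h (edgeMass_eq_zero hp0 h')

lemma enorm_rpow_le_differ (hp0 : 0 < p) (hp1 : p ≤ 1) (a : ℕ → 𝕜) (j : ℕ) :
    ‖a j‖ₑ ^ p ≤ ‖differ 𝕜 par w a j‖ₑ ^ p + edgeMass p w j * ‖a (par j)‖ₑ ^ p := by
  rw [← enorm_rpow_ofReal_mul hp0]
  refine le_trans (le_of_eq ?_) (enorm_rpow_add_le hp0 hp1 _ _)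
  simp

lemma enorm_rpow_differ_le (hp0 : 0 < p) (hp1 : p ≤ 1) (a : ℕ → 𝕜) (j : ℕ) :
    ‖differ 𝕜 par w a j‖ₑ ^ p ≤ ‖a j‖ₑ ^ p + edgeMass p w j * ‖a (par j)‖ₑ ^ p := by
  rw [← enorm_rpow_ofReal_mul hp0]
  exact enorm_rpow_sub_le hp0 hp1 _ _

/-- The mass `|w j|^p` is at most `1/2`, and `|w j| ≤ |w j|^p` because `|w j| ≤ 1` and `p ≤ 1`. -/
lemma IsForest.abs_weight_le_half (h : IsForest p par w) (hp0 : 0 < p) (hp1 : p ≤ 1) (j : ℕ) :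
    |w j| ≤ 1 / 2 := by
  have h1 : ‖w j‖ₑ ≤ 1 := by
    by_contra hc
    push Not at hc
    have h2 : (1 : ℝ≥0∞) ≤ ‖w j‖ₑ ^ p := ENNReal.one_le_rpow hc.le hp0
    have h3 := h2.trans (h.mass_le_half j)
    norm_num at h3
  have h2 : ‖w j‖ₑ ≤ 2⁻¹ := by
    refine le_trans ?_ (h.mass_le_half j)
    calc ‖w j‖ₑ = ‖w j‖ₑ ^ (1 : ℝ) := (ENNReal.rpow_one _).symm
      _ ≤ ‖w j‖ₑ ^ p := ENNReal.rpow_le_rpow_of_exponent_ge h1 hp1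
  have h3 : ENNReal.ofReal |w j| ≤ ENNReal.ofReal (1 / 2) := by
    rw [← Real.norm_eq_abs, ofReal_norm]
    refine h2.trans (le_of_eq ?_)
    rw [one_div, ENNReal.ofReal_inv_of_pos (by norm_num)]
    norm_num
  exact (ENNReal.ofReal_le_ofReal_iff (by norm_num)).1 h3

lemma tsum_children (g : ℕ → ℝ≥0∞) :
    ∑' j, edgeMass p w j * g (par j) =
      ∑' k, g k * ∑' j, (if par j = k then edgeMass p w j else 0) := by
  simp_rw [← ENNReal.tsum_mul_left]
  rw [ENNReal.tsum_comm]
  refine tsum_congr fun j => ?_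
  rw [tsum_eq_single (par j)]
  · simp [mul_comm]
  · intro k hk
    simp [hk.symm]

/-- Keeping the deficiency `1 - ∑ masses` turns the bound into an identity. This allows nodes, such
as leaves, whose children do not carry away all of the mass. -/
lemma IsForest.tsum_mass_add (h : IsForest p par w) (g : ℕ → ℝ≥0∞) :
    ∑' j, edgeMass p w j * g (par j) +
      ∑' k, g k * (1 - ∑' j, (if par j = k then edgeMass p w j else 0)) = ∑' k, g k := by
  rw [tsum_children, ← ENNReal.tsum_add]
  refine tsum_congr fun k => ?_
  rw [← mul_add, add_tsub_cancel_of_le (h.sum_children_le k), mul_one]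

lemma IsForest.tsum_mass_le (h : IsForest p par w) (g : ℕ → ℝ≥0∞) :
    ∑' j, edgeMass p w j * g (par j) ≤ ∑' k, g k := by
  rw [← h.tsum_mass_add g]
  exact le_self_add

lemma IsForest.pSum_differ_le (h : IsForest p par w) (hp0 : 0 < p) (hp1 : p ≤ 1) (a : ℕ → 𝕜) :
    pSum p (differ 𝕜 par w a) ≤ 2 * pSum p a := by
  calc pSum p (differ 𝕜 par w a)
      ≤ ∑' j, (‖a j‖ₑ ^ p + edgeMass p w j * ‖a (par j)‖ₑ ^ p) :=
        ENNReal.tsum_le_tsum fun j => enorm_rpow_differ_le hp0 hp1 a j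
    _ = pSum p a + ∑' j, edgeMass p w j * ‖a (par j)‖ₑ ^ p := ENNReal.tsum_add
    _ ≤ pSum p a + pSum p a := by
        gcongr
        exact h.tsum_mass_le fun k => ‖a k‖ₑ ^ p
    _ = 2 * pSum p a := (two_mul _).symm

end Basic

/-! ### Greedy sets and the almost greedy inequality. -/

section Greedy

variable {𝕜 : Type*} [RCLike 𝕜] {p : ℝ} {par : ℕ → ℕ} {w : ℕ → ℝ}

/-- Since `|w j| ≤ 1/2`, subtracting `w j * a (par j)` from the larger number `a j` leaves at least
`|w j| * |a (par j)|`. -/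
lemma IsForest.mass_mul_le_differ (h : IsForest p par w) (hp0 : 0 < p) (hp1 : p ≤ 1)
    (a : ℕ → 𝕜) (j : ℕ) (hj : ‖a (par j)‖ ≤ ‖a j‖) :
    edgeMass p w j * ‖a (par j)‖ₑ ^ p ≤ ‖differ 𝕜 par w a j‖ₑ ^ p := by
  rw [← enorm_rpow_ofReal_mul hp0]
  refine ENNReal.rpow_le_rpow ?_ hp0.le
  rw [enorm_le_iff_norm_le, norm_mul, RCLike.norm_ofReal, differ_apply]
  have h1 := h.abs_weight_le_half hp0 hp1 j
  have h2 := norm_sub_norm_le (a j) ((w j : 𝕜) * a (par j))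
  rw [norm_mul, RCLike.norm_ofReal] at h2
  nlinarith [norm_nonneg (a (par j)), abs_nonneg (w j)]

/-- Mass that leaves the finite set `P` through its boundary edges and its deficient nodes. -/
noncomputable def outflow (p : ℝ) (par : ℕ → ℕ) (w : ℕ → ℝ) (P : Finset ℕ) (m : ℕ → ℝ≥0∞) :
    ℝ≥0∞ :=
  ∑' j, (if j ∉ P ∧ par j ∈ P then edgeMass p w j * m (par j) else 0) +
    ∑' k, (if k ∈ P then m k else 0) *
      (1 - ∑' j, (if par j = k then edgeMass p w j else 0))

/-- The mass at a node of `P` goes to a child in `P`, to a child outside `P`, or is lost to the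
deficiency. -/
lemma IsForest.outflow_add (h : IsForest p par w) (P : Finset ℕ) (m : ℕ → ℝ≥0∞) :
    outflow p par w P m +
      ∑' j, (if j ∈ P ∧ par j ∈ P then edgeMass p w j * m (par j) else 0) = ∑ k ∈ P, m k := by
  have h1 := h.tsum_mass_add fun k => if k ∈ P then m k else 0
  rw [outflow, add_right_comm, ← ENNReal.tsum_add]
  have h2 : ∑' k, (if k ∈ P then m k else 0) = ∑ k ∈ P, m k := by
    rw [tsum_eq_sum (s := P)]
    · exact Finset.sum_congr rfl fun k hk => by simp [hk]
    · intro k hk; simp [hk]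
  rw [← h2, ← h1]
  congr 1
  refine tsum_congr fun j => ?_
  by_cases hj : j ∈ P <;> by_cases hk : par j ∈ P <;> simp [hj, hk]

/-- The mass of a node of `P` is at most its own difference plus the inflow from its parent. If the
parent is outside `P`, the inflow is at most the difference too, by greediness. The inflow from
inside `P` is finite and cancels in the balance. -/
lemma IsForest.outflow_le (h : IsForest p par w) (hp0 : 0 < p) (hp1 : p ≤ 1)
    (a : ℕ → 𝕜) (P : Finset ℕ) (hP : ∀ j ∈ P, ∀ k ∉ P, ‖a k‖ ≤ ‖a j‖) :
    outflow p par w P (fun k => ‖a k‖ₑ ^ p) ≤ 2 * pSum p (differ 𝕜 par w a) := by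
  set inner := ∑' j, (if j ∈ P ∧ par j ∈ P then edgeMass p w j * ‖a (par j)‖ₑ ^ p else 0)
    with hinner
  have h1 := h.outflow_add P fun k => ‖a k‖ₑ ^ p
  have hfin : ∑ k ∈ P, ‖a k‖ₑ ^ p ≠ ∞ :=
    ENNReal.sum_ne_top.2 fun k _ => ENNReal.rpow_ne_top_of_nonneg hp0.le enorm_ne_top
  have hin : inner ≠ ∞ := by
    refine ne_top_of_le_ne_top hfin ?_
    rw [← h1]
    exact le_add_self
  have h2 : ∑ k ∈ P, ‖a k‖ₑ ^ p ≤ 2 * pSum p (differ 𝕜 par w a) + inner := by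
    calc ∑ k ∈ P, ‖a k‖ₑ ^ p = ∑' k, (if k ∈ P then ‖a k‖ₑ ^ p else 0) := by
          rw [tsum_eq_sum (s := P)]
          · exact Finset.sum_congr rfl fun k hk => by simp [hk]
          · intro k hk; simp [hk]
      _ ≤ ∑' k, (2 * ‖differ 𝕜 par w a k‖ₑ ^ p +
            (if k ∈ P ∧ par k ∈ P then edgeMass p w k * ‖a (par k)‖ₑ ^ p else 0)) := by
          refine ENNReal.tsum_le_tsum fun k => ?_
          by_cases hk : k ∈ P
          · have h3 := enorm_rpow_le_differ (par := par) (w := w) hp0 hp1 a k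
            by_cases hk' : par k ∈ P
            · simp only [hk, hk', and_self, if_true]
              refine h3.trans ?_
              gcongr
              rw [two_mul]; exact le_self_add
            · simp only [hk, hk', and_false, if_true, if_false, add_zero]
              refine h3.trans ?_
              rw [two_mul]
              gcongr
              exact h.mass_mul_le_differ hp0 hp1 a k (hP k hk _ hk')
          · simp [hk]
      _ = 2 * pSum p (differ 𝕜 par w a) + inner := by
          rw [ENNReal.tsum_add, ENNReal.tsum_mul_left, pSum]
  rw [← h1] at h2
  exact (ENNReal.add_le_add_iff_right hin).1 h2

/-- Removing a finite greedy set from the coefficients is bounded. -/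
lemma IsForest.pSum_differ_remove_le (h : IsForest p par w) (hp0 : 0 < p) (hp1 : p ≤ 1)
    (a : ℕ → 𝕜) (P : Finset ℕ) (hP : ∀ j ∈ P, ∀ k ∉ P, ‖a k‖ ≤ ‖a j‖) :
    pSum p (differ 𝕜 par w fun j => if j ∈ P then 0 else a j) ≤
      3 * pSum p (differ 𝕜 par w a) := by
  have h1 : pSum p (differ 𝕜 par w fun j => if j ∈ P then 0 else a j) ≤
      pSum p (differ 𝕜 par w a) + outflow p par w P (fun k => ‖a k‖ₑ ^ p) := by
    calc pSum p (differ 𝕜 par w fun j => if j ∈ P then 0 else a j)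
        ≤ ∑' j, (‖differ 𝕜 par w a j‖ₑ ^ p +
          (if j ∉ P ∧ par j ∈ P then edgeMass p w j * ‖a (par j)‖ₑ ^ p else 0)) := by
          refine ENNReal.tsum_le_tsum fun j => ?_
          by_cases hj : j ∈ P <;> by_cases hk : par j ∈ P
          · simp [hj, hk, hp0]
          · have := h.mass_mul_le_differ hp0 hp1 a j (hP j hj _ hk)
            rw [← enorm_rpow_ofReal_mul hp0] at this
            simpa [hj, hk] using this
          · simpa [hj, hk] using enorm_rpow_le_differ (par := par) (w := w) hp0 hp1 a j
          · simp [hj, hk]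
      _ ≤ _ := by
          rw [ENNReal.tsum_add, pSum, outflow]
          gcongr
          exact le_self_add
  refine h1.trans ?_
  calc _ ≤ pSum p (differ 𝕜 par w a) + 2 * pSum p (differ 𝕜 par w a) := by
        gcongr; exact h.outflow_le hp0 hp1 a P hP
    _ = 3 * pSum p (differ 𝕜 par w a) := by ring

/-- Lower democracy: a finite greedy set is controlled by the quasi-norm. -/
lemma IsForest.card_mul_le (h : IsForest p par w) (hp0 : 0 < p) (hp1 : p ≤ 1)
    (a : ℕ → 𝕜) (P : Finset ℕ) (hP : ∀ j ∈ P, ∀ k ∉ P, ‖a k‖ ≤ ‖a j‖) (t : ℝ≥0∞)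
    (ht : ∀ j ∈ P, t ≤ ‖a j‖ₑ ^ p) :
    P.card * t ≤ 4 * pSum p (differ 𝕜 par w a) := by
  rcases P.eq_empty_or_nonempty with rfl | ⟨i, hi⟩
  · simp
  have htop : t ≠ ∞ := ne_top_of_le_ne_top
    (ENNReal.rpow_ne_top_of_nonneg hp0.le enorm_ne_top) (ht i hi)
  have h1 := h.outflow_add P fun _ => t
  rw [Finset.sum_const, nsmul_eq_mul] at h1
  -- This is where the bound one half is essential: for a constant mass `t`, at most half of the
  -- total stays inside `P`, so at least half flows out.
  have h2 : ∑' j, (if j ∈ P ∧ par j ∈ P then edgeMass p w j * t else 0) ≤ 2⁻¹ * (P.card * t) := by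
    calc _ ≤ ∑' j, (if j ∈ P then 2⁻¹ * t else 0) := by
          refine ENNReal.tsum_le_tsum fun j => ?_
          by_cases hj : j ∈ P
          · by_cases hk : par j ∈ P
            · simp only [hj, hk, and_self, if_true]
              gcongr
              exact h.mass_le_half j
            · simp [hk]
          · simp [hj]
      _ = ∑ j ∈ P, 2⁻¹ * t := by
          rw [tsum_eq_sum (s := P)]
          · exact Finset.sum_congr rfl fun k hk => by simp [hk]
          · intro k hk; simp [hk]
      _ = 2⁻¹ * (P.card * t) := by rw [Finset.sum_const, nsmul_eq_mul]; ring
  have h3 : outflow p par w P (fun _ => t) ≤ outflow p par w P (fun k => ‖a k‖ₑ ^ p) := by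
    unfold outflow
    gcongr with j k
    · split_ifs with hj
      · gcongr; exact ht _ hj.2
      · exact le_rfl
    · split_ifs with hk
      · exact ht _ hk
      · exact le_rfl
  have h4 := h3.trans (h.outflow_le hp0 hp1 a P hP)
  have hfin : (P.card : ℝ≥0∞) * t ≠ ∞ := ENNReal.mul_ne_top (ENNReal.natCast_ne_top _) htop
  have h5 : (P.card : ℝ≥0∞) * t ≤ 2 * pSum p (differ 𝕜 par w a) + 2⁻¹ * (P.card * t) := by
    conv_lhs => rw [← h1]
    gcongr
  have h6 : (2⁻¹ : ℝ≥0∞) * (P.card * t) ≤ 2 * pSum p (differ 𝕜 par w a) := by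
    have h7 : (P.card : ℝ≥0∞) * t = 2⁻¹ * (P.card * t) + 2⁻¹ * (P.card * t) := by
      rw [← add_mul, ENNReal.inv_two_add_inv_two, one_mul]
    have h8 : (2⁻¹ : ℝ≥0∞) * (P.card * t) ≠ ∞ := ENNReal.mul_ne_top (by simp) hfin
    rw [h7] at h5
    have h9 : (2⁻¹ : ℝ≥0∞) * (2⁻¹ * (P.card * t) + 2⁻¹ * (P.card * t)) = 2⁻¹ * (P.card * t) := by
      rw [← h7]
    rw [h9] at h5
    exact (ENNReal.add_le_add_iff_right h8).1 h5
  calc (P.card : ℝ≥0∞) * t = 2 * (2⁻¹ * (P.card * t)) := by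
        rw [← mul_assoc, ENNReal.mul_inv_cancel (by simp) (by simp), one_mul]
    _ ≤ 2 * (2 * pSum p (differ 𝕜 par w a)) := by gcongr
    _ = 4 * pSum p (differ 𝕜 par w a) := by ring

/-- The almost greedy inequality for coefficient sequences. -/
lemma IsForest.pSum_differ_greedy_le (h : IsForest p par w) (hp0 : 0 < p) (hp1 : p ≤ 1)
    (a : ℕ → 𝕜) (A D : Finset ℕ) (hA : ∀ j ∈ A, ∀ k ∉ A, ‖a k‖ ≤ ‖a j‖)
    (hcard : D.card = A.card) :
    pSum p (differ 𝕜 par w fun j => if j ∈ A then 0 else a j) ≤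
      11 * pSum p (differ 𝕜 par w fun j => if j ∈ D then 0 else a j) := by
  -- `A \ D` is a greedy set of `b`. Removing it from `b` and adding back the entries of `a` on `D \
  -- A` gives `a` off `A`. These entries are as many as those on `A \ D` and no larger, so lower
  -- democracy controls them.
  set b : ℕ → 𝕜 := fun j => if j ∈ D then 0 else a j with hb
  set P := A \ D with hPdef
  have hP : ∀ j ∈ P, ∀ k ∉ P, ‖b k‖ ≤ ‖b j‖ := by
    intro j hj k hk
    rw [hPdef, Finset.mem_sdiff] at hj hk
    by_cases hkD : k ∈ D
    · simp [hb, hkD]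
    · have hkA : k ∉ A := fun h => hk ⟨h, hkD⟩
      simpa [hb, hkD, hj.2] using hA j hj.1 k hkA
  have h1 := h.pSum_differ_remove_le hp0 hp1 b P hP
  set c : ℕ → 𝕜 := fun j => if j ∈ D \ A then a j else 0 with hc
  have hdec : (fun j => if j ∈ A then 0 else a j) = (fun j => if j ∈ P then 0 else b j) + c := by
    ext j
    by_cases hjA : j ∈ A <;> by_cases hjD : j ∈ D <;> simp [hPdef, hb, hc, hjA, hjD]
  have h2 : pSum p c ≤ 4 * pSum p (differ 𝕜 par w b) := by
    have hPc : P.card = (D \ A).card := by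
      rw [hPdef]
      have e1 := Finset.card_sdiff_add_card_inter A D
      have e2 := Finset.card_sdiff_add_card_inter D A
      rw [Finset.inter_comm] at e2
      omega
    have hsum : pSum p c = ∑ j ∈ D \ A, ‖a j‖ₑ ^ p := by
      rw [pSum, tsum_eq_sum (s := D \ A)]
      · exact Finset.sum_congr rfl fun k hk => by simp only [hc, hk, if_true]
      · intro k hk; simp only [hc, hk, if_false, enorm_zero, ENNReal.zero_rpow_of_pos hp0]
    rcases (D \ A).eq_empty_or_nonempty with he | hne
    · rw [hsum, he]; simp
    obtain ⟨i, hi, himax⟩ := Finset.exists_max_image (D \ A) (fun j => ‖a j‖ₑ ^ p) hne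
    have hle := h.card_mul_le hp0 hp1 b P hP (‖a i‖ₑ ^ p) (by
      intro j hj
      rw [hPdef, Finset.mem_sdiff] at hj
      rw [Finset.mem_sdiff] at hi
      refine ENNReal.rpow_le_rpow ?_ hp0.le
      simp only [hb, hj.2, if_false]
      exact enorm_le_iff_norm_le.2 (hA j hj.1 i hi.2))
    refine le_trans ?_ hle
    rw [hsum, hPc, ← nsmul_eq_mul]
    exact Finset.sum_le_card_nsmul _ _ _ himax
  rw [hdec, map_add]
  calc _ ≤ pSum p (differ 𝕜 par w fun j => if j ∈ P then 0 else b j) +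
        pSum p (differ 𝕜 par w c) := pSum_add_le hp0 hp1 _ _
    -- The constant `11` is `3 + 2 * 4`: removal, then the bound `2` for `differ`, then lower
    -- democracy.
    _ ≤ 3 * pSum p (differ 𝕜 par w b) + 2 * (4 * pSum p (differ 𝕜 par w b)) := by
        gcongr
        exact (h.pSum_differ_le hp0 hp1 c).trans (by gcongr)
    _ = 11 * pSum p (differ 𝕜 par w b) := by ring

end Greedy

/-! ### Recovering coefficients from differences. -/

/-- `dep` counts the edges of nonzero weight above a node. -/
def IsDepth (par : ℕ → ℕ) (w : ℕ → ℝ) (dep : ℕ → ℕ) : Prop :=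
  ∀ j, w j ≠ 0 → dep j = dep (par j) + 1

/-- `n` steps of the recursion `a j = f j + w j * a (par j)`. -/
noncomputable def integAux (𝕜 : Type*) [RCLike 𝕜] (par : ℕ → ℕ) (w : ℕ → ℝ) :
    ℕ → (ℕ → 𝕜) →ₗ[𝕜] (ℕ → 𝕜)
  | 0 => 0
  | n + 1 =>
    { toFun := fun f j => f j + (w j : 𝕜) * integAux 𝕜 par w n f (par j)
      map_add' := fun f g => by ext j; simp only [map_add, Pi.add_apply]; ring
      map_smul' := fun c f => by
        ext j; simp only [map_smul, Pi.smul_apply, smul_eq_mul, RingHom.id_apply]; ring }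

/-- The inverse of `differ`. -/
noncomputable def integ (𝕜 : Type*) [RCLike 𝕜] (par : ℕ → ℕ) (w : ℕ → ℝ) (dep : ℕ → ℕ) :
    (ℕ → 𝕜) →ₗ[𝕜] (ℕ → 𝕜) where
  toFun f j := integAux 𝕜 par w (dep j + 1) f j
  map_add' f g := by ext j; simp
  map_smul' c f := by ext j; simp

section Integ

variable {𝕜 : Type*} [RCLike 𝕜] {p : ℝ} {par : ℕ → ℕ} {w : ℕ → ℝ} {dep : ℕ → ℕ}

lemma integ_apply (hdep : IsDepth par w dep) (f : ℕ → 𝕜) (j : ℕ) :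
    integ 𝕜 par w dep f j = f j + (w j : 𝕜) * integ 𝕜 par w dep f (par j) := by
  change f j + (w j : 𝕜) * integAux 𝕜 par w (dep j) f (par j) =
    f j + (w j : 𝕜) * integAux 𝕜 par w (dep (par j) + 1) f (par j)
  by_cases h : w j = 0
  · simp [h]
  · rw [hdep j h]

lemma differ_integ (hdep : IsDepth par w dep) (f : ℕ → 𝕜) :
    differ 𝕜 par w (integ 𝕜 par w dep f) = f := by
  ext j
  rw [differ_apply, integ_apply hdep f j, add_sub_cancel_right]

lemma differ_injective (hdep : IsDepth par w dep) :
    Function.Injective (differ 𝕜 par w) := by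
  rw [← LinearMap.ker_eq_bot, LinearMap.ker_eq_bot']
  intro a ha
  have : ∀ n j, dep j = n → a j = 0 := by
    intro n
    induction n with
    | zero =>
      intro j hj
      have h := congrFun ha j
      rw [differ_apply] at h
      have hw : w j = 0 := by
        by_contra hw
        have := hdep j hw
        omega
      simpa [hw] using h
    | succ n ih =>
      intro j hj
      have h := congrFun ha j
      rw [differ_apply] at h
      by_cases hw : w j = 0
      · simpa [hw] using h
      · have := hdep j hw
        rw [ih (par j) (by omega)] at h
        simpa using h
  ext j
  exact this _ j rfl

lemma integ_differ (hdep : IsDepth par w dep) (a : ℕ → 𝕜) :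
    integ 𝕜 par w dep (differ 𝕜 par w a) = a :=
  differ_injective hdep (differ_integ hdep _)

end Integ

/-! ### Upper bounds for the coefficients on a set of given size. -/

/-- Transport of mass from each node to its children. -/
noncomputable def massShift (p : ℝ) (par : ℕ → ℕ) (w : ℕ → ℝ) (φ : ℕ → ℝ≥0∞) : ℕ → ℝ≥0∞ :=
  fun j => edgeMass p w j * φ (par j)

section Upper

variable {𝕜 : Type*} [RCLike 𝕜] {p : ℝ} {par : ℕ → ℕ} {w : ℕ → ℝ} {dep : ℕ → ℕ}

lemma IsForest.tsum_massShift_le (h : IsForest p par w) (φ : ℕ → ℝ≥0∞) (l : ℕ) :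
    ∑' j, (massShift p par w)^[l] φ j ≤ ∑' j, φ j := by
  induction l with
  | zero => rfl
  | succ l ih =>
    rw [Function.iterate_succ_apply']
    exact (h.tsum_mass_le _).trans ih

lemma massShift_eq_zero (hp0 : 0 < p) (hdep : IsDepth par w dep) (φ : ℕ → ℝ≥0∞) (l : ℕ) :
    ∀ j, dep j < l → (massShift p par w)^[l] φ j = 0 := by
  induction l with
  | zero => intro j hj; omega
  | succ l ih =>
    intro j hj
    rw [Function.iterate_succ_apply', massShift]
    by_cases hw : w j = 0
    · rw [edgeMass_eq_zero hp0 hw, zero_mul]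
    · have := hdep j hw
      rw [ih _ (by omega), mul_zero]

/-- After `l` shifts, mass lives only at depth at least `l`, so by monotonicity of `e` the next edge
costs at least the factor `2⁻¹ ^ e l`. -/
lemma massShift_le (hp0 : 0 < p) (hdep : IsDepth par w dep) {e : ℕ → ℕ} (he : Monotone e)
    (hw : ∀ j, w j ≠ 0 → edgeMass p w j ≤ 2⁻¹ ^ e (dep (par j)))
    (φ : ℕ → ℝ≥0∞) (B : ℝ≥0∞) (hB : ∀ j, φ j ≤ B) (l : ℕ) :
    ∀ j, (massShift p par w)^[l] φ j ≤ 2⁻¹ ^ (∑ i ∈ Finset.range l, e i) * B := by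
  induction l with
  | zero => intro j; simpa using hB j
  | succ l ih =>
    intro j
    rw [Function.iterate_succ_apply', massShift]
    by_cases hwj : w j = 0
    · rw [edgeMass_eq_zero hp0 hwj, zero_mul]; exact zero_le
    by_cases hl : dep (par j) < l
    · rw [massShift_eq_zero hp0 hdep φ l _ hl, mul_zero]; exact zero_le
    · rw [Finset.sum_range_succ, pow_add, mul_comm (2⁻¹ ^ _) (2⁻¹ ^ e l), mul_assoc]
      gcongr
      · refine (hw j hwj).trans (pow_le_pow_right_of_le_one' (by simp) (he (by omega)))
      · exact ih _

/-- The recursion `a j = f j + w j * a (par j)` is unrolled `n` times. For `n > dep j` the last term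
vanishes. -/
lemma enorm_rpow_le_sum_massShift (hp0 : 0 < p) (hp1 : p ≤ 1) (a : ℕ → 𝕜) (n : ℕ) :
    ∀ j, ‖a j‖ₑ ^ p ≤
      ∑ l ∈ Finset.range n, (massShift p par w)^[l] (fun k => ‖differ 𝕜 par w a k‖ₑ ^ p) j +
        (massShift p par w)^[n] (fun k => ‖a k‖ₑ ^ p) j := by
  induction n with
  | zero => intro j; simp
  | succ n ih =>
    intro j
    rw [Finset.sum_range_succ']
    simp only [Function.iterate_succ_apply', Function.iterate_zero, id_eq]
    refine (enorm_rpow_le_differ (par := par) (w := w) hp0 hp1 a j).trans ?_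
    rw [add_comm, add_right_comm]
    gcongr
    simp only [massShift]
    rw [← Finset.mul_sum, ← mul_add]
    gcongr
    exact ih _

/-- The coefficients over a finite set of size at most `m`. -/
lemma IsForest.sum_coord_le (h : IsForest p par w) (hp0 : 0 < p) (hp1 : p ≤ 1)
    (hdep : IsDepth par w dep) {e : ℕ → ℕ} (he : Monotone e)
    (hw : ∀ j, w j ≠ 0 → edgeMass p w j ≤ 2⁻¹ ^ e (dep (par j)))
    (a : ℕ → 𝕜) (A : Finset ℕ) (m : ℕ) (hA : A.card ≤ m) :
    ∑ j ∈ A, ‖a j‖ₑ ^ p ≤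
      (∑' l, min 1 ((m : ℝ≥0∞) * 2⁻¹ ^ (∑ i ∈ Finset.range l, e i))) *
        pSum p (differ 𝕜 par w a) := by
  set F : ℕ → ℝ≥0∞ := fun k => ‖differ 𝕜 par w a k‖ₑ ^ p with hF
  have h1 : ∀ j, ‖a j‖ₑ ^ p ≤ ∑' l, (massShift p par w)^[l] F j := by
    intro j
    have h2 := enorm_rpow_le_sum_massShift (par := par) (w := w) hp0 hp1 a (dep j + 1) j
    rw [massShift_eq_zero hp0 hdep _ _ _ (Nat.lt_succ_self _), add_zero] at h2
    exact h2.trans (ENNReal.sum_le_tsum _)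
  calc ∑ j ∈ A, ‖a j‖ₑ ^ p ≤ ∑ j ∈ A, ∑' l, (massShift p par w)^[l] F j :=
        Finset.sum_le_sum fun j _ => h1 j
    _ = ∑' l, ∑ j ∈ A, (massShift p par w)^[l] F j :=
        (Summable.tsum_finsetSum fun _ _ => ENNReal.summable).symm
    _ ≤ ∑' l, min 1 ((m : ℝ≥0∞) * 2⁻¹ ^ (∑ i ∈ Finset.range l, e i)) *
          pSum p (differ 𝕜 par w a) := by
        refine ENNReal.tsum_le_tsum fun l => ?_
        have hs : ∑' j, F j = pSum p (differ 𝕜 par w a) := rfl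
        -- The bound `1` is conservation of the total mass in the `l`-th shift; the other bound is
        -- `m` times the largest single value.
        rcases min_choice (1 : ℝ≥0∞) ((m : ℝ≥0∞) * 2⁻¹ ^ (∑ i ∈ Finset.range l, e i)) with hm | hm
        · rw [hm, one_mul]
          exact (ENNReal.sum_le_tsum A).trans (h.tsum_massShift_le F l)
        · rw [hm]
          calc _ ≤ ∑ j ∈ A, 2⁻¹ ^ (∑ i ∈ Finset.range l, e i) * pSum p (differ 𝕜 par w a) :=
                Finset.sum_le_sum fun j _ => massShift_le hp0 hdep he hw F _
                  (fun k => by rw [← hs]; exact ENNReal.le_tsum k) l j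
            _ = A.card * (2⁻¹ ^ (∑ i ∈ Finset.range l, e i) * pSum p (differ 𝕜 par w a)) := by
                rw [Finset.sum_const, nsmul_eq_mul]
            _ ≤ m * (2⁻¹ ^ (∑ i ∈ Finset.range l, e i) * pSum p (differ 𝕜 par w a)) := by
                gcongr
            _ = _ := by ring
    _ = _ := ENNReal.tsum_mul_right

end Upper

/-! ### From forests to bases of quasi-normed spaces. -/

/-- A quasi-normed space whose elements are represented by sequences with equivalent quasi-norm, in
which the vectors `v k` are represented by the vectors of a weighted forest. -/
structure IsForestModel {𝕜 Y : Type*} [RCLike 𝕜] [AddCommGroup Y] [Module 𝕜 Y] [Norm Y]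
    (p : ℝ) (par : ℕ → ℕ) (w : ℕ → ℝ) (G : Y →ₗ[𝕜] (ℕ → 𝕜)) (K : ℝ) (v : ℕ → Y) : Prop where
  pos : 0 < K
  norm_nonneg : ∀ f : Y, 0 ≤ ‖f‖
  injective : Function.Injective G
  pSum_le : ∀ f, pSum p (G f) ≤ ENNReal.ofReal (K * ‖f‖ ^ p)
  norm_le : ∀ f, ENNReal.ofReal (‖f‖ ^ p) ≤ ENNReal.ofReal K * pSum p (G f)
  map_vec : ∀ k, G (v k) = differ 𝕜 par w (Pi.single k 1)
  closedSpan_eq : closedSpan 𝕜 (Set.range v) = ⊤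

/-- A bound for the sum of the `p`-th powers of `m` coordinates with respect to a forest whose
edges of depth `i` have mass at most `2 ^ (-e i)`. -/
noncomputable def massBound (e : ℕ → ℕ) (m : ℕ) : ℝ≥0∞ :=
  ∑' l, min 1 ((m : ℝ≥0∞) * 2⁻¹ ^ (∑ i ∈ Finset.range l, e i))

namespace IsForestModel

variable {𝕜 Y : Type*} [RCLike 𝕜] [AddCommGroup Y] [Module 𝕜 Y] [Norm Y]
  {p : ℝ} {par : ℕ → ℕ} {w : ℕ → ℝ} {dep : ℕ → ℕ} {G : Y →ₗ[𝕜] (ℕ → 𝕜)} {K : ℝ} {v : ℕ → Y}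

lemma norm_le_of_pSum_le (M : IsForestModel p par w G K v) (hp0 : 0 < p) {f g : Y} {C : ℝ}
    (hC : 0 ≤ C) (h : pSum p (G f) ≤ ENNReal.ofReal C * pSum p (G g)) :
    ‖f‖ ≤ (K ^ 2 * C) ^ (1 / p) * ‖g‖ := by
  have hK := M.pos
  have hf := M.norm_nonneg f
  have hg := M.norm_nonneg g
  have h1 : ‖f‖ ^ p ≤ K ^ 2 * C * ‖g‖ ^ p := by
    refine (ENNReal.ofReal_le_ofReal_iff (by positivity)).1 ?_
    calc ENNReal.ofReal (‖f‖ ^ p) ≤ ENNReal.ofReal K * pSum p (G f) := M.norm_le f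
      _ ≤ ENNReal.ofReal K * (ENNReal.ofReal C * ENNReal.ofReal (K * ‖g‖ ^ p)) := by
          gcongr
          exact h.trans (by gcongr; exact M.pSum_le g)
      _ = ENNReal.ofReal (K ^ 2 * C * ‖g‖ ^ p) := by
          rw [← ENNReal.ofReal_mul hC, ← ENNReal.ofReal_mul hK.le]
          congr 1; ring
  calc ‖f‖ = (‖f‖ ^ p) ^ (1 / p) := by
        rw [← Real.rpow_mul hf, mul_one_div_cancel hp0.ne', Real.rpow_one]
    _ ≤ (K ^ 2 * C * ‖g‖ ^ p) ^ (1 / p) := by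
        refine Real.rpow_le_rpow (by positivity) h1 (by positivity)
    _ = (K ^ 2 * C) ^ (1 / p) * ‖g‖ := by
        rw [Real.mul_rpow (by positivity) (by positivity), ← Real.rpow_mul hg,
          mul_one_div_cancel hp0.ne', Real.rpow_one]

lemma map_sum (M : IsForestModel p par w G K v) (a : ℕ → 𝕜) (A : Finset ℕ) :
    G (∑ n ∈ A, a n • v n) = differ 𝕜 par w fun j => if j ∈ A then a j else 0 := by
  simp only [_root_.map_sum, map_smul, M.map_vec]
  simp only [← map_smul]
  rw [← _root_.map_sum]
  congr 1
  ext j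
  simp [Finset.sum_apply, Pi.single_apply]

lemma map_proj (M : IsForestModel p par w G K v) {B : MBasis 𝕜 Y} (hv : B.vec = v)
    (hc : ∀ j f, B.coord j f = integ 𝕜 par w dep (G f) j) (A : Finset ℕ) (f : Y) :
    G (B.proj A f) =
      differ 𝕜 par w fun j => if j ∈ A then integ 𝕜 par w dep (G f) j else 0 := by
  rw [MBasis.proj, hv, M.map_sum (fun n => B.coord n f)]
  simp only [hc]

lemma map_sub_proj (M : IsForestModel p par w G K v) (hdep : IsDepth par w dep)
    {B : MBasis 𝕜 Y} (hv : B.vec = v)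
    (hc : ∀ j f, B.coord j f = integ 𝕜 par w dep (G f) j) (A : Finset ℕ) (f : Y) :
    G (f - B.proj A f) =
      differ 𝕜 par w fun j => if j ∈ A then 0 else integ 𝕜 par w dep (G f) j := by
  rw [map_sub, M.map_proj hv hc]
  conv_lhs => rw [← differ_integ hdep (G f)]
  rw [← map_sub]
  congr 1
  ext j
  rw [Pi.sub_apply, differ_integ hdep]
  split_ifs <;> simp

lemma isAlmostGreedy (M : IsForestModel p par w G K v) (hp0 : 0 < p) (hp1 : p ≤ 1)
    (h : IsForest p par w) (hdep : IsDepth par w dep) {B : MBasis 𝕜 Y} (hv : B.vec = v)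
    (hc : ∀ j f, B.coord j f = integ 𝕜 par w dep (G f) j) : B.IsAlmostGreedy := by
  refine ⟨(K ^ 2 * 11) ^ (1 / p), fun f A D hA hcard => ?_⟩
  refine M.norm_le_of_pSum_le hp0 (by norm_num) ?_
  rw [M.map_sub_proj hdep hv hc, M.map_sub_proj hdep hv hc]
  refine (h.pSum_differ_greedy_le hp0 hp1 _ A D ?_ hcard).trans (by simp)
  intro j hj k hk
  simpa only [hc] using hA j hj k hk

lemma norm_proj_le (M : IsForestModel p par w G K v) (hp0 : 0 < p) (hp1 : p ≤ 1)
    (h : IsForest p par w) (hdep : IsDepth par w dep) {e : ℕ → ℕ} (he : Monotone e)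
    (hw : ∀ j, w j ≠ 0 → edgeMass p w j ≤ 2⁻¹ ^ e (dep (par j)))
    {B : MBasis 𝕜 Y} (hv : B.vec = v) (hc : ∀ j f, B.coord j f = integ 𝕜 par w dep (G f) j)
    {m : ℕ} {C : ℝ} (hC : 0 ≤ C) (hm : massBound e m ≤ ENNReal.ofReal C)
    (A : Finset ℕ) (hA : A.card ≤ m) (f : Y) :
    ‖B.proj A f‖ ≤ (K ^ 2 * (2 * C)) ^ (1 / p) * ‖f‖ := by
  refine M.norm_le_of_pSum_le hp0 (by positivity) ?_
  rw [M.map_proj hv hc]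
  have h1 := h.sum_coord_le hp0 hp1 hdep he hw (integ 𝕜 par w dep (G f)) A m hA
  rw [differ_integ hdep] at h1
  have h2 : pSum p (fun j => if j ∈ A then integ 𝕜 par w dep (G f) j else 0) =
      ∑ j ∈ A, ‖integ 𝕜 par w dep (G f) j‖ₑ ^ p := by
    rw [pSum, tsum_eq_sum (s := A)]
    · exact Finset.sum_congr rfl fun k hk => by simp only [hk, if_true]
    · intro k hk; simp only [hk, if_false, enorm_zero, ENNReal.zero_rpow_of_pos hp0]
  refine (h.pSum_differ_le hp0 hp1 _).trans ?_
  rw [h2, ENNReal.ofReal_mul (by norm_num), mul_assoc]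
  gcongr
  · simp
  · exact h1.trans (by gcongr; exact hm)

/-- One finitely supported test vector bounds the projection constants from below, up to the
equivalence constant of the model. -/
lemma le_of_norm_proj_le (M : IsForestModel p par w G K v) (hp0 : 0 < p)
    (hdep : IsDepth par w dep) {B : MBasis 𝕜 Y} (hv : B.vec = v)
    (hc : ∀ j f, B.coord j f = integ 𝕜 par w dep (G f) j)
    {C R : ℝ} (hC : 0 ≤ C) (a : ℕ → 𝕜) (T A : Finset ℕ) (hT : ∀ j ∉ T, a j = 0)
    (ha : pSum p (differ 𝕜 par w a) ≤ 1) (hR0 : 0 ≤ R)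
    (hR : ENNReal.ofReal R ≤ pSum p (differ 𝕜 par w fun j => if j ∈ A then a j else 0))
    (hproj : ∀ f, ‖B.proj A f‖ ≤ C * ‖f‖) : (R / K ^ 2) ^ (1 / p) ≤ C := by
  have hK := M.pos
  set f : Y := ∑ n ∈ T, a n • v n with hf
  have hGf : G f = differ 𝕜 par w a := by
    rw [hf, M.map_sum]
    congr 1
    ext j
    by_cases hj : j ∈ T
    · simp [hj]
    · simp [hj, hT j hj]
  have hf0 := M.norm_nonneg f
  have hpf0 := M.norm_nonneg (B.proj A f)
  have h1 : ‖f‖ ^ p ≤ K := by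
    refine (ENNReal.ofReal_le_ofReal_iff hK.le).1 ?_
    refine (M.norm_le f).trans ?_
    rw [hGf]
    exact mul_le_of_le_one_right' ha
  have h2 : R ≤ K ^ 2 * C ^ p := by
    have h3 : R ≤ K * ‖B.proj A f‖ ^ p := by
      refine (ENNReal.ofReal_le_ofReal_iff (by positivity)).1 (le_trans ?_ (M.pSum_le _))
      rw [M.map_proj hv hc, hGf, integ_differ hdep]
      exact hR
    have h4 : ‖B.proj A f‖ ^ p ≤ C ^ p * K := by
      calc ‖B.proj A f‖ ^ p ≤ (C * ‖f‖) ^ p := Real.rpow_le_rpow hpf0 (hproj f) hp0.le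
        _ = C ^ p * ‖f‖ ^ p := Real.mul_rpow hC hf0
        _ ≤ C ^ p * K := by gcongr
    calc R ≤ K * ‖B.proj A f‖ ^ p := h3
      _ ≤ K * (C ^ p * K) := by gcongr
      _ = K ^ 2 * C ^ p := by ring
  calc (R / K ^ 2) ^ (1 / p) ≤ (C ^ p) ^ (1 / p) := by
        refine Real.rpow_le_rpow (by positivity) ?_ (by positivity)
        rw [div_le_iff₀ (by positivity)]
        linarith
    _ = C := by rw [← Real.rpow_mul hC, mul_one_div_cancel hp0.ne', Real.rpow_one]

/-- The coordinate functionals are obtained by solving the recursion. Their uniform boundedness is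
the coefficient bound for sets with one element, `massBound e 1`. -/
lemma exists_mBasis (M : IsForestModel p par w G K v) (hp0 : 0 < p) (hp1 : p ≤ 1)
    (h : IsForest p par w) (hdep : IsDepth par w dep) {e : ℕ → ℕ} (he : Monotone e)
    (hw : ∀ j, w j ≠ 0 → edgeMass p w j ≤ 2⁻¹ ^ e (dep (par j)))
    {C : ℝ} (hC : 0 ≤ C) (hm : massBound e 1 ≤ ENNReal.ofReal C) :
    ∃ B : MBasis 𝕜 Y, B.vec = v ∧ ∀ j f, B.coord j f = integ 𝕜 par w dep (G f) j := by
  have hK := M.pos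
  have hint : ∀ k, integ 𝕜 par w dep (G (v k)) = Pi.single k 1 := fun k => by
    rw [M.map_vec, integ_differ hdep]
  have hcoord : ∀ (f : Y) (j : ℕ), ‖integ 𝕜 par w dep (G f) j‖ ≤ (C * K) ^ (1 / p) * ‖f‖ := by
    intro f j
    have hf0 := M.norm_nonneg f
    have h1 := h.sum_coord_le hp0 hp1 hdep he hw (integ 𝕜 par w dep (G f)) {j} 1 (by simp)
    rw [differ_integ hdep, Finset.sum_singleton] at h1
    have h2 : ‖integ 𝕜 par w dep (G f) j‖ ^ p ≤ C * K * ‖f‖ ^ p := by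
      refine (ENNReal.ofReal_le_ofReal_iff (by positivity)).1 ?_
      rw [← ENNReal.ofReal_rpow_of_nonneg (_root_.norm_nonneg _) hp0.le, ofReal_norm]
      calc _ ≤ massBound e 1 * pSum p (G f) := h1
        _ ≤ ENNReal.ofReal C * ENNReal.ofReal (K * ‖f‖ ^ p) := by
            gcongr
            exact M.pSum_le f
        _ = _ := by rw [← ENNReal.ofReal_mul hC, mul_assoc]
    calc ‖integ 𝕜 par w dep (G f) j‖ = (‖integ 𝕜 par w dep (G f) j‖ ^ p) ^ (1 / p) := by
          rw [← Real.rpow_mul (_root_.norm_nonneg _), mul_one_div_cancel hp0.ne', Real.rpow_one]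
      _ ≤ (C * K * ‖f‖ ^ p) ^ (1 / p) :=
          Real.rpow_le_rpow (by positivity) h2 (by positivity)
      _ = (C * K) ^ (1 / p) * ‖f‖ := by
          rw [Real.mul_rpow (by positivity) (by positivity), ← Real.rpow_mul hf0,
            mul_one_div_cancel hp0.ne', Real.rpow_one]
  have hsingle : ∀ k, pSum p (Pi.single k 1 : ℕ → 𝕜) = 1 := by
    intro k
    rw [pSum, tsum_eq_single k]
    · simp
    · intro j hj; simp [hj, hp0]
  refine ⟨{
    vec := v
    coord := fun j => LinearMap.proj j ∘ₗ integ 𝕜 par w dep ∘ₗ G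
    biorthogonal := ?_
    fundamental := M.closedSpan_eq
    total := ?_
    norm_vec_lower := ?_
    norm_vec_upper := ?_
    norm_coord := ⟨_, fun n f => hcoord f n⟩ }, rfl, fun _ _ => rfl⟩
  · intro m n
    simp [hint, Pi.single_apply]
  · intro f hf
    have h1 : integ 𝕜 par w dep (G f) = 0 := funext hf
    have h2 : G f = 0 := by rw [← differ_integ hdep (G f), h1, map_zero]
    exact M.injective (by rw [h2, map_zero])
  -- The coordinate of `v n` at `n` is `1`, so the bound for the functionals keeps `‖v n‖` away from
  -- zero.
  · refine ⟨1 / ((C * K) ^ (1 / p) + 1), by positivity, fun n => ?_⟩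
    have h1 := hcoord (v n) n
    rw [hint] at h1
    simp only [Pi.single_eq_same, norm_one] at h1
    have hv0 := M.norm_nonneg (v n)
    rw [div_le_iff₀ (by positivity)]
    nlinarith
  · refine ⟨(K * 2) ^ (1 / p), fun n => ?_⟩
    have hv0 := M.norm_nonneg (v n)
    have h1 : ‖v n‖ ^ p ≤ K * 2 := by
      refine (ENNReal.ofReal_le_ofReal_iff (by positivity)).1 ((M.norm_le _).trans ?_)
      rw [M.map_vec, ENNReal.ofReal_mul hK.le]
      gcongr
      refine (h.pSum_differ_le hp0 hp1 _).trans ?_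
      rw [hsingle]; simp
    calc ‖v n‖ = (‖v n‖ ^ p) ^ (1 / p) := by
          rw [← Real.rpow_mul hv0, mul_one_div_cancel hp0.ne', Real.rpow_one]
      _ ≤ _ := Real.rpow_le_rpow (by positivity) h1 (by positivity)

end IsForestModel

/-- The space has an almost greedy basis whose conditionality constants grow like `(log m) ^ a`. -/
def HasAlmostGreedyBasisWithGrowth (𝕜 Y : Type*) [RCLike 𝕜] [AddCommGroup Y] [Module 𝕜 Y] [Norm Y]
    (a : ℝ) : Prop :=
  ∃ B : MBasis 𝕜 Y, B.IsAlmostGreedy ∧ ∃ c C : ℝ, 0 < c ∧ 0 < C ∧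
    ∀ m : ℕ, 2 ≤ m → c * Real.log m ^ a ≤ B.conditionalityConst m ∧
      B.conditionalityConst m ≤ C * Real.log m ^ a

/-- The hypotheses concern `p`-th powers, hence the exponent `a * p`; taking `p`-th roots gives
growth of order `a`. -/
theorem IsForestModel.hasAlmostGreedyBasisWithGrowth
    {𝕜 Y : Type*} [RCLike 𝕜] [AddCommGroup Y] [Module 𝕜 Y] [Norm Y]
    {p : ℝ} {par : ℕ → ℕ} {w : ℕ → ℝ} {dep : ℕ → ℕ} {G : Y →ₗ[𝕜] (ℕ → 𝕜)} {K : ℝ} {v : ℕ → Y}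
    (M : IsForestModel p par w G K v) (hp0 : 0 < p) (hp1 : p ≤ 1)
    (h : IsForest p par w) (hdep : IsDepth par w dep) {e : ℕ → ℕ} (he : Monotone e)
    (hw : ∀ j, w j ≠ 0 → edgeMass p w j ≤ 2⁻¹ ^ e (dep (par j))) {a : ℝ}
    (hup : ∃ C : ℝ, 0 < C ∧ ∀ m : ℕ, 2 ≤ m →
      massBound e m ≤ ENNReal.ofReal (C * Real.log m ^ (a * p)))
    (hlow : ∃ c : ℝ, 0 < c ∧ ∀ m : ℕ, 2 ≤ m → ∃ (b : ℕ → 𝕜) (T A : Finset ℕ),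
      (∀ j ∉ T, b j = 0) ∧ pSum p (differ 𝕜 par w b) ≤ 1 ∧ A.card ≤ m ∧
      ENNReal.ofReal (c * Real.log m ^ (a * p)) ≤
        pSum p (differ 𝕜 par w fun j => if j ∈ A then b j else 0)) :
    HasAlmostGreedyBasisWithGrowth 𝕜 Y a := by
  have hK := M.pos
  obtain ⟨C, hC, hup⟩ := hup
  obtain ⟨c, hc0, hlow⟩ := hlow
  have hlog : ∀ m : ℕ, 2 ≤ m → 0 < Real.log m := fun m hm =>
    Real.log_pos (by exact_mod_cast hm)
  have hpow : ∀ (D : ℝ) (m : ℕ), 0 ≤ D → 2 ≤ m →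
      (D * Real.log m ^ (a * p)) ^ (1 / p) = D ^ (1 / p) * Real.log m ^ a := by
    intro D m hD hm
    have := hlog m hm
    rw [Real.mul_rpow hD (by positivity), ← Real.rpow_mul this.le, mul_assoc,
      mul_one_div_cancel hp0.ne', mul_one]
  -- The growth bound starts at `m = 2`, because `log 1 = 0`; the case `m = 1` follows by
  -- monotonicity in `m`.
  have hone : massBound e 1 ≤ ENNReal.ofReal (C * Real.log (2 : ℕ) ^ (a * p)) := by
    refine le_trans ?_ (hup 2 le_rfl)
    refine ENNReal.tsum_le_tsum fun l => ?_
    gcongr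
    norm_num
  obtain ⟨B, hv, hc⟩ := M.exists_mBasis hp0 hp1 h hdep he hw
    (by have := hlog 2 le_rfl; positivity) hone
  refine ⟨B, M.isAlmostGreedy hp0 hp1 h hdep hv hc, (c / K ^ 2) ^ (1 / p),
    (K ^ 2 * (2 * C)) ^ (1 / p), by positivity, by positivity, fun m hm => ?_⟩
  have hlm := hlog m hm
  have hmem : (K ^ 2 * (2 * C)) ^ (1 / p) * Real.log m ^ a ∈
      {C : ℝ | 0 ≤ C ∧ ∀ A : Finset ℕ, A.card ≤ m → ∀ f : Y, ‖B.proj A f‖ ≤ C * ‖f‖} := by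
    refine ⟨by positivity, fun A hA f => ?_⟩
    have h1 := M.norm_proj_le hp0 hp1 h hdep he hw hv hc (by positivity) (hup m hm) A hA f
    rwa [← hpow _ m (by positivity) hm, mul_assoc, mul_assoc]
  refine ⟨le_csInf ⟨_, hmem⟩ ?_, csInf_le ⟨0, fun x hx => hx.1⟩ hmem⟩
  rintro D ⟨hD, hproj⟩
  obtain ⟨b, T, A, hT, hb, hA, hR⟩ := hlow m hm
  have h1 := M.le_of_norm_proj_le hp0 hdep hv hc hD b T A hT hb (by positivity) hR
    (fun f => hproj A hA f)
  rwa [← hpow _ m (by positivity) hm, div_mul_eq_mul_div]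

/-! ### Branching exponents and the heights of trees. -/

/-- The depth exponents of a sequence of branching exponents. -/
def levelSum (e : ℕ → ℕ) (l : ℕ) : ℕ := ∑ i ∈ Finset.range l, e i

lemma levelSum_zero (e : ℕ → ℕ) : levelSum e 0 = 0 := rfl

lemma levelSum_succ (e : ℕ → ℕ) (l : ℕ) : levelSum e (l + 1) = levelSum e l + e l :=
  Finset.sum_range_succ _ _

lemma levelSum_add_le {e : ℕ → ℕ} (he : ∀ i, 1 ≤ e i) (l t : ℕ) :
    levelSum e l + t ≤ levelSum e (l + t) := by
  induction t with
  | zero => rfl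
  | succ t ih =>
    have := he (l + t)
    rw [← add_assoc l t 1, levelSum_succ]
    omega

/-- The first `L` terms are at most one each. Beyond them the terms are dominated by a geometric
series of sum `2`, since every `e i ≥ 1`. -/
lemma massBound_le {e : ℕ → ℕ} (he : ∀ i, 1 ≤ e i) {m L : ℕ} (hL : m ≤ 2 ^ levelSum e L) :
    massBound e m ≤ L + 2 := by
  have h2 : ∑' t : ℕ, (2⁻¹ : ℝ≥0∞) ^ t = 2 := by
    rw [ENNReal.tsum_geometric, ENNReal.one_sub_inv_two, inv_inv]
  set F : ℕ → ℝ≥0∞ := fun l => min 1 ((m : ℝ≥0∞) * 2⁻¹ ^ levelSum e l) with hF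
  have h3 : massBound e m = ∑ l ∈ Finset.range L, F l + ∑' t, F (t + L) :=
    (Summable.sum_add_tsum_nat_add' (f := F) (k := L) ENNReal.summable).symm
  rw [h3]
  refine add_le_add ?_ ?_
  · calc _ ≤ ∑ i ∈ Finset.range L, (1 : ℝ≥0∞) := Finset.sum_le_sum fun i _ => min_le_left _ _
      _ = L := by simp
  · rw [← h2]
    refine ENNReal.tsum_le_tsum fun t => (min_le_right _ _).trans ?_
    calc (m : ℝ≥0∞) * 2⁻¹ ^ levelSum e (t + L)
        ≤ 2 ^ levelSum e L * (2⁻¹ ^ (levelSum e L + t)) := by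
          refine mul_le_mul' (by exact_mod_cast hL)
            (pow_le_pow_right_of_le_one' (by simp) ?_)
          rw [add_comm t L]
          exact levelSum_add_le he L t
      _ = (2 * 2⁻¹) ^ levelSum e L * 2⁻¹ ^ t := by rw [pow_add, mul_pow, mul_assoc]
      _ = 2⁻¹ ^ t := by rw [ENNReal.mul_inv_cancel (by simp) (by simp), one_pow, one_mul]

/-- Branching exponents for which the height of a tree with `m` nodes is of the order of
`(log m) ^ r`. -/
theorem exists_branching_exponents {r : ℝ} (hr0 : 0 < r) (hr1 : r ≤ 1) :
    ∃ e : ℕ → ℕ, Monotone e ∧ (∀ i, 2 ≤ e i) ∧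
      (∃ C : ℝ, 0 < C ∧ ∀ m : ℕ, 2 ≤ m → massBound e m ≤ ENNReal.ofReal (C * Real.log m ^ r)) ∧
      ∃ c : ℝ, 0 < c ∧ ∀ m : ℕ, 2 ≤ m → ∃ N : ℕ, 2 ^ (levelSum e N + 1) ≤ m ∧
        c * Real.log m ^ r ≤ ((N : ℝ) + 1) / 2 := by
  obtain ⟨q, hq1, rfl⟩ : ∃ q : ℝ, 1 ≤ q ∧ r = 1 / q :=
    ⟨1 / r, by rw [le_div_iff₀ hr0]; linarith, by simp⟩
  have hq0 : 0 < q := by linarith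
  -- The sum of `(i + 1)^(q-1)` over `i < l` has order `l^q`. The extra `+ 1` ensures `2 ≤ e i`, so
  -- that consecutive levels are never both selected when an infinite tree is coarsened.
  set e : ℕ → ℕ := fun i => ⌈((i : ℝ) + 1) ^ (q - 1)⌉₊ + 1 with he
  have he2 : ∀ i, 2 ≤ e i := fun i => by
    have : 0 < ⌈((i : ℝ) + 1) ^ (q - 1)⌉₊ := Nat.ceil_pos.2 (by positivity)
    simp only [he]
    omega
  have he1 : ∀ i, 1 ≤ e i := fun i => one_le_two.trans (he2 i)
  have hmono : Monotone e := by
    intro i j hij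
    simp only [he]
    gcongr
  have hlow : ∀ l : ℕ, (l : ℝ) ^ q ≤ q * levelSum e l := by
    intro l
    induction l with
    | zero => simp [levelSum_zero, hq0.ne']
    | succ l ih =>
      rw [levelSum_succ]
      push_cast
      have hl : (0 : ℝ) < (l : ℝ) + 1 := by positivity
      have h1 : ((l : ℝ) + 1) ^ (q - 1) ≤ e l := by
        simp only [he]; push_cast
        linarith [Nat.le_ceil (((l : ℝ) + 1) ^ (q - 1))]
      -- Bernoulli's inequality for `(1 - 1/(l+1))^q`, multiplied by `(l+1)^q`.
      have h2 : ((l : ℝ) + 1) ^ q - q * ((l : ℝ) + 1) ^ (q - 1) ≤ (l : ℝ) ^ q := by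
        have h3 := one_add_mul_self_le_rpow_one_add (s := -(1 / ((l : ℝ) + 1)))
          (by
            have : 1 / ((l : ℝ) + 1) ≤ 1 := by rw [div_le_one hl]; linarith [l.cast_nonneg (α := ℝ)]
            linarith) hq1
        have h4 : (1 : ℝ) + -(1 / ((l : ℝ) + 1)) = l / (l + 1) := by field_simp; ring
        rw [h4, Real.div_rpow (by positivity) hl.le, le_div_iff₀ (by positivity)] at h3
        refine le_trans (le_of_eq ?_) h3
        rw [Real.rpow_sub_one hl.ne']
        field_simp
        ring
      nlinarith
  have hupp : ∀ l : ℕ, (levelSum e (l + 1) : ℝ) ≤ 3 * ((l : ℝ) + 1) ^ q := by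
    intro l
    have hl : (0 : ℝ) < (l : ℝ) + 1 := by positivity
    have h0 : (1 : ℝ) ≤ ((l : ℝ) + 1) ^ (q - 1) :=
      Real.one_le_rpow (by linarith [l.cast_nonneg (α := ℝ)]) (by linarith)
    have h1 : ∀ i ∈ Finset.range (l + 1), (e i : ℝ) ≤ 3 * ((l : ℝ) + 1) ^ (q - 1) := by
      intro i hi
      have hi' : i ≤ l := by simpa [Nat.lt_succ_iff] using hi
      have h2 : (e i : ℝ) ≤ e l := by exact_mod_cast hmono hi'
      have h3 : (e l : ℝ) ≤ ((l : ℝ) + 1) ^ (q - 1) + 2 := by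
        simp only [he]; push_cast
        linarith [Nat.ceil_lt_add_one (show 0 ≤ ((l : ℝ) + 1) ^ (q - 1) by positivity)]
      linarith
    have h2 := Finset.sum_le_card_nsmul _ _ _ h1
    rw [Finset.card_range, nsmul_eq_mul] at h2
    rw [levelSum]
    push_cast at h2 ⊢
    refine h2.trans (le_of_eq ?_)
    rw [Real.rpow_sub_one hl.ne']
    field_simp
  have hlog2 : (1 : ℝ) / 2 ≤ Real.log 2 := by linarith [Real.log_two_gt_d9]
  have hlogm : ∀ m : ℕ, 2 ≤ m → (1 : ℝ) / 2 ≤ Real.log m := fun m hm =>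
    hlog2.trans (Real.log_le_log (by norm_num) (by exact_mod_cast hm))
  refine ⟨e, hmono, he2, ⟨(2 * q) ^ (1 / q) + 3 * 2 ^ (1 / q), by positivity, fun m hm => ?_⟩,
    1 / 8, by norm_num, fun m hm => ?_⟩
  · have hlm := hlogm m hm
    have hlm0 : 0 < Real.log m := by linarith
    -- Chosen so that `L^q ≥ 2 * q * log m`; the factor `2` absorbs `log 2 ≥ 1/2`.
    set L := ⌈(2 * q * Real.log m) ^ (1 / q)⌉₊ with hLdef
    have hL : m ≤ 2 ^ levelSum e L := by
      have h1 : (2 * q * Real.log m) ^ (1 / q) ≤ L := Nat.le_ceil _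
      have h2 : 2 * q * Real.log m ≤ (L : ℝ) ^ q := by
        calc 2 * q * Real.log m = ((2 * q * Real.log m) ^ (1 / q)) ^ q := by
              rw [← Real.rpow_mul (by positivity), one_div_mul_cancel hq0.ne', Real.rpow_one]
          _ ≤ (L : ℝ) ^ q := Real.rpow_le_rpow (by positivity) h1 hq0.le
      have h3 : 2 * Real.log m ≤ levelSum e L := by
        have := h2.trans (hlow L)
        rw [mul_comm 2 q, mul_assoc] at this
        exact le_of_mul_le_mul_left this hq0
      have h4 : Real.log m ≤ Real.log ((2 : ℝ) ^ levelSum e L) := by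
        rw [Real.log_pow]
        nlinarith
      have h5 := (Real.log_le_log_iff (by positivity) (by positivity)).1 h4
      exact_mod_cast h5
    refine (massBound_le he1 hL).trans ?_
    have h6 : (L : ℝ) + 2 ≤ ((2 * q) ^ (1 / q) + 3 * 2 ^ (1 / q)) * Real.log m ^ (1 / q) := by
      have h7 : (L : ℝ) < (2 * q * Real.log m) ^ (1 / q) + 1 :=
        Nat.ceil_lt_add_one (by positivity)
      have h8 : (1 : ℝ) ≤ (2 * Real.log m) ^ (1 / q) :=
        Real.one_le_rpow (by linarith) (by positivity)
      rw [Real.mul_rpow (by positivity) hlm0.le] at h7 h8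
      linarith
    calc (L : ℝ≥0∞) + 2 = ENNReal.ofReal ((L : ℝ) + 2) := by
          rw [ENNReal.ofReal_add (by positivity) (by norm_num)]; simp
      _ ≤ _ := ENNReal.ofReal_le_ofReal h6
  · have hlm := hlogm m hm
    have hlm0 : 0 < Real.log m := by linarith
    -- The largest height whose tree is guaranteed to have at most `m` nodes. The value `n = 0`
    -- always qualifies because `m ≥ 2`, and maximality bounds `log m` through level `N + 1`.
    set N := Nat.findGreatest (fun n => 2 ^ (levelSum e n + 1) ≤ m) m with hN
    refine ⟨N, ?_, ?_⟩
    · exact Nat.findGreatest_spec (P := fun n => 2 ^ (levelSum e n + 1) ≤ m) (Nat.zero_le m)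
        (by simpa [levelSum_zero] using hm)
    · have h1 : m < 2 ^ (levelSum e (N + 1) + 1) := by
        by_contra hcon
        push Not at hcon
        have h2 : N + 1 ≤ m := by
          have h3 := levelSum_add_le he1 0 (N + 1)
          rw [levelSum_zero, Nat.zero_add (N + 1)] at h3
          have h4 : N + 1 < 2 ^ (N + 1) := Nat.lt_two_pow_self
          have h5 : 2 ^ (N + 1) ≤ 2 ^ (levelSum e (N + 1) + 1) :=
            Nat.pow_le_pow_right (by norm_num) (by omega)
          omega
        have := Nat.le_findGreatest (P := fun n => 2 ^ (levelSum e n + 1) ≤ m) h2 hcon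
        omega
      have h2 : Real.log m ≤ 4 * ((N : ℝ) + 1) ^ q := by
        have h3 : Real.log m ≤ Real.log ((2 : ℝ) ^ (levelSum e (N + 1) + 1)) :=
          Real.log_le_log (by positivity) (by exact_mod_cast h1.le)
        rw [Real.log_pow] at h3
        push_cast at h3
        have h4 := hupp N
        have h5 : (1 : ℝ) ≤ ((N : ℝ) + 1) ^ q :=
          Real.one_le_rpow (by linarith [N.cast_nonneg (α := ℝ)]) hq0.le
        have h6 : Real.log 2 ≤ 1 := by linarith [Real.log_two_lt_d9]
        have h7 : (0 : ℝ) ≤ levelSum e (N + 1) := Nat.cast_nonneg _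
        nlinarith
      have h3 : Real.log m ^ (1 / q) ≤ 4 * ((N : ℝ) + 1) := by
        calc Real.log m ^ (1 / q) ≤ (4 * ((N : ℝ) + 1) ^ q) ^ (1 / q) :=
              Real.rpow_le_rpow hlm0.le h2 (by positivity)
          _ = 4 ^ (1 / q) * ((N : ℝ) + 1) := by
              rw [Real.mul_rpow (by norm_num) (by positivity), ← Real.rpow_mul (by positivity),
                mul_one_div_cancel hq0.ne', Real.rpow_one]
          _ ≤ 4 ^ (1 : ℝ) * ((N : ℝ) + 1) := by
              gcongr
              · norm_num
          _ = 4 * ((N : ℝ) + 1) := by rw [Real.rpow_one]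
      linarith

/-! ### Finite trees, and gluing them to a forest. -/

/-- The number `2 ^ (-n / p)`. -/
noncomputable def halfPow (p : ℝ) (n : ℕ) : ℝ := ((1 / 2 : ℝ) ^ n) ^ (1 / p)

lemma halfPow_add (p : ℝ) (m n : ℕ) : halfPow p (m + n) = halfPow p m * halfPow p n := by
  rw [halfPow, pow_add, Real.mul_rpow (by positivity) (by positivity)]; rfl

lemma halfPow_zero (p : ℝ) : halfPow p 0 = 1 := by simp [halfPow]

lemma enorm_rpow_inv {p : ℝ} (hp0 : 0 < p) {x : ℝ} (hx : 0 ≤ x) :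
    ‖x ^ (1 / p)‖ₑ ^ p = ENNReal.ofReal x := by
  rw [← ofReal_norm, Real.norm_of_nonneg (by positivity),
    ENNReal.ofReal_rpow_of_nonneg (by positivity) hp0.le, ← Real.rpow_mul hx,
    one_div_mul_cancel hp0.ne', Real.rpow_one]

lemma enorm_halfPow {p : ℝ} (hp0 : 0 < p) (n : ℕ) : ‖halfPow p n‖ₑ ^ p = 2⁻¹ ^ n := by
  rw [halfPow, enorm_rpow_inv hp0 (by positivity), ENNReal.ofReal_pow (by norm_num), one_div,
    ENNReal.ofReal_inv_of_pos (by norm_num)]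
  norm_num

lemma tsum_le_of_injOn_support {ι : Type*} (f : ι → ℝ≥0∞) (g : ι → ℕ) (n : ℕ) (c : ℝ≥0∞)
    (hg : ∀ j, f j ≠ 0 → g j < n) (hinj : ∀ i j, f i ≠ 0 → f j ≠ 0 → g i = g j → i = j)
    (hc : ∀ j, f j ≠ 0 → f j ≤ c) : ∑' j, f j ≤ n * c := by
  classical
  rw [ENNReal.tsum_eq_iSup_sum]
  refine iSup_le fun s => ?_
  rw [← Finset.sum_filter_ne_zero]
  calc _ ≤ (s.filter fun j => f j ≠ 0).card • c :=
        Finset.sum_le_card_nsmul _ _ _ fun j hj => hc j (Finset.mem_filter.1 hj).2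
    _ ≤ n * c := by
        rw [nsmul_eq_mul]
        gcongr
        rw [← Finset.card_range n]
        refine Finset.card_le_card_of_injOn g ?_ ?_
        · intro j hj
          simpa using hg j (Finset.mem_filter.1 hj).2
        · intro i hi j hj hij
          exact hinj i j (Finset.mem_filter.1 hi).2 (Finset.mem_filter.1 hj).2 hij

/-- The nodes of a disjoint union of finite trees: `(N, l, x)` is the `x`-th node of depth `l` of
the `N`-th tree, whose height is `N`. -/
def treeNodes (e : ℕ → ℕ) : Set (ℕ × ℕ × ℕ) := {x | x.2.1 ≤ x.1 ∧ x.2.2 < 2 ^ levelSum e x.2.1}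

/-- The parent of a node; a root is its own parent. -/
def treeParent (e : ℕ → ℕ) (x : ℕ × ℕ × ℕ) : ℕ × ℕ × ℕ :=
  (x.1, x.2.1 - 1, x.2.2 / 2 ^ e (x.2.1 - 1))

lemma treeParent_mem {e : ℕ → ℕ} {x : ℕ × ℕ × ℕ} (hx : x ∈ treeNodes e) :
    treeParent e x ∈ treeNodes e := by
  obtain ⟨N, l, y⟩ := x
  obtain ⟨h1, h2⟩ := hx
  simp only [treeNodes, treeParent, Set.mem_ofPred_eq] at *
  refine ⟨by omega, ?_⟩
  cases l with
  | zero =>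
    rw [levelSum_zero, pow_zero] at h2 ⊢
    exact lt_of_le_of_lt (Nat.div_le_self _ _) h2
  | succ l =>
    rw [levelSum_succ, pow_add] at h2
    exact Nat.div_lt_of_lt_mul (by rwa [mul_comm])

/-- The weighted forests on a part `S` of `ℕ`. -/
structure IsPartialForest (p : ℝ) (e : ℕ → ℕ) (S : Set ℕ) (par : ℕ → ℕ) (w : ℕ → ℝ)
    (dep : ℕ → ℕ) : Prop where
  mem : ∀ j ∈ S, w j ≠ 0 → par j ∈ S
  depth : ∀ j ∈ S, w j ≠ 0 → dep j = dep (par j) + 1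
  mass_le : ∀ j ∈ S, w j ≠ 0 → edgeMass p w j ≤ 2⁻¹ ^ e (dep (par j))
  sum_children_le : ∀ k, ∑' j, (S.indicator (fun j => if par j = k then edgeMass p w j else 0) j) ≤ 1

/-- The data of a forest on `S`, together with a copy of the disjoint union of finite trees on the
complement of `S`. -/
structure GlueData (p : ℝ) (e : ℕ → ℕ) (S : Set ℕ) (par : ℕ → ℕ) (w : ℕ → ℝ) (dep : ℕ → ℕ)
    (E : PartialEquiv ℕ (ℕ × ℕ × ℕ)) : Prop extends IsPartialForest p e S par w dep where
  one_le : ∀ i, 1 ≤ e i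
  source_eq : E.source = Sᶜ
  target_eq : E.target = treeNodes e

open Classical in
/-- Parents in the glued forest. -/
noncomputable def glueParent (e : ℕ → ℕ) (S : Set ℕ) (par : ℕ → ℕ)
    (E : PartialEquiv ℕ (ℕ × ℕ × ℕ)) (j : ℕ) : ℕ :=
  if j ∈ S then par j else E.symm (treeParent e (E j))

open Classical in
/-- Weights in the glued forest. -/
noncomputable def glueWeight (p : ℝ) (e : ℕ → ℕ) (S : Set ℕ) (w : ℕ → ℝ)
    (E : PartialEquiv ℕ (ℕ × ℕ × ℕ)) (j : ℕ) : ℝ :=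
  if j ∈ S then w j else if (E j).2.1 = 0 then 0 else halfPow p (e ((E j).2.1 - 1))

open Classical in
/-- Depths in the glued forest. -/
noncomputable def glueDepth (S : Set ℕ) (dep : ℕ → ℕ)
    (E : PartialEquiv ℕ (ℕ × ℕ × ℕ)) (j : ℕ) : ℕ :=
  if j ∈ S then dep j else (E j).2.1

namespace GlueData

variable {p : ℝ} {e : ℕ → ℕ} {S : Set ℕ} {par : ℕ → ℕ} {w : ℕ → ℝ} {dep : ℕ → ℕ}
  {E : PartialEquiv ℕ (ℕ × ℕ × ℕ)}

lemma map_mem (D : GlueData p e S par w dep E) {j : ℕ} (hj : j ∉ S) : E j ∈ treeNodes e := by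
  rw [← D.target_eq]
  exact E.map_source (by rw [D.source_eq]; exact hj)

lemma symm_notMem (D : GlueData p e S par w dep E) {x : ℕ × ℕ × ℕ} (hx : x ∈ treeNodes e) :
    E.symm x ∉ S := by
  have := E.map_target (x := x) (by rw [D.target_eq]; exact hx)
  rwa [D.source_eq] at this

lemma right_inv (D : GlueData p e S par w dep E) {x : ℕ × ℕ × ℕ} (hx : x ∈ treeNodes e) :
    E (E.symm x) = x :=
  E.right_inv (by rw [D.target_eq]; exact hx)

lemma left_inv (D : GlueData p e S par w dep E) {j : ℕ} (hj : j ∉ S) : E.symm (E j) = j :=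
  E.left_inv (by rw [D.source_eq]; exact hj)

lemma parent_notMem (D : GlueData p e S par w dep E) {j : ℕ} (hj : j ∉ S) :
    glueParent e S par E j ∉ S := by
  rw [glueParent, if_neg hj]
  exact D.symm_notMem (treeParent_mem (D.map_mem hj))

lemma map_parent (D : GlueData p e S par w dep E) {j : ℕ} (hj : j ∉ S) :
    E (glueParent e S par E j) = treeParent e (E j) := by
  rw [glueParent, if_neg hj]
  exact D.right_inv (treeParent_mem (D.map_mem hj))

lemma edgeMass_of_mem {j : ℕ} (hj : j ∈ S) :
    edgeMass p (glueWeight p e S w E) j = edgeMass p w j := by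
  rw [edgeMass, glueWeight, if_pos hj, edgeMass]

lemma isDepth (D : GlueData p e S par w dep E) :
    IsDepth (glueParent e S par E) (glueWeight p e S w E) (glueDepth S dep E) := by
  intro j hj
  by_cases hjS : j ∈ S
  · have hw : w j ≠ 0 := by simpa [glueWeight, hjS] using hj
    have h1 := D.mem j hjS hw
    simp only [glueDepth, glueParent, hjS, if_true, h1]
    exact D.depth j hjS hw
  · have h1 := D.parent_notMem hjS
    have h2 : (E j).2.1 ≠ 0 := by
      intro h0
      simp [glueWeight, hjS, h0] at hj
    rw [glueDepth, if_neg hjS, glueDepth, if_neg h1, D.map_parent hjS, treeParent]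
    simp only
    omega

lemma mass_le_pow (D : GlueData p e S par w dep E) (hp0 : 0 < p) (j : ℕ)
    (hj : glueWeight p e S w E j ≠ 0) :
    edgeMass p (glueWeight p e S w E) j ≤
      2⁻¹ ^ e (glueDepth S dep E (glueParent e S par E j)) := by
  by_cases hjS : j ∈ S
  · have hw : w j ≠ 0 := by simpa [glueWeight, hjS] using hj
    have h1 := D.mem j hjS hw
    rw [edgeMass_of_mem hjS]
    simp only [glueDepth, glueParent, hjS, if_true, h1]
    exact D.mass_le j hjS hw
  · have h1 := D.parent_notMem hjS
    have h2 : (E j).2.1 ≠ 0 := by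
      intro h0
      simp [glueWeight, hjS, h0] at hj
    rw [glueDepth, if_neg h1, D.map_parent hjS, treeParent, edgeMass, glueWeight, if_neg hjS,
      if_neg h2, enorm_halfPow hp0]

lemma isForest (D : GlueData p e S par w dep E) (hp0 : 0 < p) :
    IsForest p (glueParent e S par E) (glueWeight p e S w E) := by
  constructor
  · intro j
    by_cases hj : glueWeight p e S w E j = 0
    · rw [edgeMass_eq_zero hp0 hj]; exact zero_le
    · refine (D.mass_le_pow hp0 j hj).trans ?_
      calc _ ≤ (2⁻¹ : ℝ≥0∞) ^ 1 := pow_le_pow_right_of_le_one' (by simp) (D.one_le _)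
        _ = 2⁻¹ := pow_one _
  · intro k
    by_cases hk : k ∈ S
    · refine le_trans (ENNReal.tsum_le_tsum fun j => ?_) (D.sum_children_le k)
      by_cases hj : j ∈ S
      · simp only [Set.indicator_of_mem hj]
        rw [edgeMass_of_mem hj, glueParent, if_pos hj]
      · rw [if_neg]
        · exact zero_le
        · rintro rfl
          exact D.parent_notMem hj hk
    · have hkey : ∀ j, (if glueParent e S par E j = k then
          edgeMass p (glueWeight p e S w E) j else 0) ≠ 0 →
          j ∉ S ∧ (E j).1 = (E k).1 ∧ (E j).2.1 = (E k).2.1 + 1 ∧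
            (E j).2.2 / 2 ^ e (E k).2.1 = (E k).2.2 := by
        intro j hj
        have h1 : glueParent e S par E j = k := by
          by_contra h; simp [h] at hj
        rw [if_pos h1] at hj
        have hw := edgeMass_ne_zero hp0 hj
        have hjS : j ∉ S := by
          intro hjS
          have hw' : w j ≠ 0 := by simpa [glueWeight, hjS] using hw
          have := D.mem j hjS hw'
          rw [glueParent, if_pos hjS] at h1
          exact hk (h1 ▸ this)
        have h2 : (E j).2.1 ≠ 0 := by
          intro h0
          simp [glueWeight, hjS, h0] at hw
        have h3 := D.map_parent hjS
        rw [h1] at h3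
        rw [h3, treeParent]
        exact ⟨hjS, rfl, by simp only; omega, rfl⟩
      calc _ ≤ ((2 ^ e (E k).2.1 : ℕ) : ℝ≥0∞) * 2⁻¹ ^ e (E k).2.1 := by
            -- The parent's position is the quotient by `2 ^ e`, so a child is identified by the
            -- remainder. There are thus at most `2 ^ e` children, each of mass `2⁻¹ ^ e`.
            refine tsum_le_of_injOn_support _ (fun j => (E j).2.2 % 2 ^ e (E k).2.1) _ _ ?_ ?_ ?_
            · intro j _
              exact Nat.mod_lt _ (by positivity)
            · intro i j hi hj hij
              obtain ⟨hiS, hi1, hi2, hi3⟩ := hkey i hi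
              obtain ⟨hjS, hj1, hj2, hj3⟩ := hkey j hj
              rw [← D.left_inv hiS, ← D.left_inv hjS]
              congr 1
              refine Prod.ext (hi1.trans hj1.symm) (Prod.ext (hi2.trans hj2.symm) ?_)
              rw [← Nat.div_add_mod (E i).2.2 (2 ^ e (E k).2.1), hi3, hij, ← hj3,
                Nat.div_add_mod]
            · intro j hj
              obtain ⟨hjS, hj1, hj2, hj3⟩ := hkey j hj
              refine le_trans (b := edgeMass p (glueWeight p e S w E) j) ?_ ?_
              · split_ifs
                exacts [le_rfl, zero_le]
              · rw [edgeMass, glueWeight, if_neg hjS, if_neg (by omega), enorm_halfPow hp0, hj2,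
                  Nat.add_sub_cancel]
        _ = 1 := by
            push_cast
            rw [← mul_pow, ENNReal.mul_inv_cancel (by simp) (by simp), one_pow]

lemma finite_children (D : GlueData p e S par w dep E) (k : ℕ) :
    {c | c ∉ S ∧ glueParent e S par E c = k ∧ glueWeight p e S w E c ≠ 0}.Finite := by
  refine Set.Finite.subset (((Set.finite_Iio (2 ^ levelSum e ((E k).2.1 + 1))).image
    fun x => E.symm ((E k).1, (E k).2.1 + 1, x))) ?_
  rintro c ⟨hc, rfl, hw⟩
  have h2 : (E c).2.1 ≠ 0 := by
    intro h0
    simp [glueWeight, hc, h0] at hw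
  have h3 := D.map_mem hc
  have h4 : (E c).2.1 - 1 + 1 = (E c).2.1 := by omega
  refine ⟨(E c).2.2, ?_, ?_⟩
  · rw [D.map_parent hc, treeParent, Set.mem_Iio, h4]
    exact h3.2
  · simp only [D.map_parent hc, treeParent, h4]
    exact D.left_inv hc

/-- The height of the tree minus the depth decreases from parent to child; it is the rank that makes
the triangular elimination in `span_differ_eq` terminate. -/
lemma rank_lt (D : GlueData p e S par w dep E) {c : ℕ} (hc : c ∉ S)
    (hw : glueWeight p e S w E c ≠ 0) :
    (E c).1 - (E c).2.1 < (E (glueParent e S par E c)).1 - (E (glueParent e S par E c)).2.1 := by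
  have h2 : (E c).2.1 ≠ 0 := by
    intro h0
    simp [glueWeight, hc, h0] at hw
  have h3 := (D.map_mem hc).1
  rw [D.map_parent hc, treeParent]
  simp only
  omega

end GlueData

/-- Bounds the number of nodes of the `N`-th tree: the levels at least double in size, so the last
one dominates. -/
lemma sum_two_pow_levelSum_le {e : ℕ → ℕ} (he : ∀ i, 1 ≤ e i) (N : ℕ) :
    ∑ l ∈ Finset.range (N + 1), 2 ^ levelSum e l ≤ 2 ^ (levelSum e N + 1) := by
  induction N with
  | zero => simp [levelSum_zero]
  | succ N ih =>
    rw [Finset.sum_range_succ, pow_succ, mul_two]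
    gcongr
    refine ih.trans (Nat.pow_le_pow_right (by norm_num) ?_)
    rw [levelSum_succ]
    have := he N
    omega

/-- The coefficients, on the `N`-th tree, of a vector of norm one with large projections. -/
theorem GlueData.exists_large_projection (𝕜 : Type*) [RCLike 𝕜] {p : ℝ} {e : ℕ → ℕ} {S : Set ℕ}
    {par : ℕ → ℕ} {w : ℕ → ℝ} {dep : ℕ → ℕ} {E : PartialEquiv ℕ (ℕ × ℕ × ℕ)}
    (D : GlueData p e S par w dep E) (hp0 : 0 < p) (N : ℕ) :
    ∃ (b : ℕ → 𝕜) (T A : Finset ℕ), (∀ j ∉ T, b j = 0) ∧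
      pSum p (differ 𝕜 (glueParent e S par E) (glueWeight p e S w E) b) ≤ 1 ∧
      A.card ≤ 2 ^ (levelSum e N + 1) ∧
      ENNReal.ofReal (((N : ℝ) + 1) / 2) ≤
        pSum p (differ 𝕜 (glueParent e S par E) (glueWeight p e S w E)
          fun j => if j ∈ A then b j else 0) := by
  classical
  set node : (Σ _ : ℕ, ℕ) → ℕ := fun y => E.symm (N, y.1, y.2) with hnode
  set I : Finset (Σ _ : ℕ, ℕ) :=
    (Finset.range (N + 1)).sigma fun l => Finset.range (2 ^ levelSum e l) with hI
  -- Only the even levels are kept, so the parent of a non-root node of `J` is never in `J`, and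
  -- `differ` leaves the coefficients on `J` unchanged.
  set J : Finset (Σ _ : ℕ, ℕ) :=
    ((Finset.range (N + 1)).filter Even).sigma fun l => Finset.range (2 ^ levelSum e l) with hJ
  have hImem : ∀ y ∈ I, (N, y.1, y.2) ∈ treeNodes e := by
    intro y hy
    simp only [hI, Finset.mem_sigma, Finset.mem_range] at hy
    exact ⟨by simp only; omega, hy.2⟩
  have hJI : J ⊆ I := Finset.sigma_mono (Finset.filter_subset _ _) fun _ => le_rfl
  have hinj : Set.InjOn node I := by
    intro y hy z hz hyz
    have h1 := D.right_inv (hImem y hy)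
    have h2 := D.right_inv (hImem z hz)
    simp only [hnode] at hyz
    rw [hyz, h2] at h1
    obtain ⟨y1, y2⟩ := y
    obtain ⟨z1, z2⟩ := z
    simp only [Prod.mk.injEq, true_and] at h1
    rw [h1.1, h1.2]
  -- On the `N`-th tree this solves `b j = w j * b (par j)` with value `1` at the root, so its
  -- differences are the unit vector of the root. Every level carries total mass one.
  set b : ℕ → 𝕜 := fun j =>
    if j ∉ S ∧ (E j).1 = N then ((halfPow p (levelSum e (E j).2.1) : ℝ) : 𝕜) else 0 with hb
  have hmemJ : ∀ j ∈ J.image node, j ∉ S ∧ (E j).1 = N ∧ Even (E j).2.1 := by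
    intro j hj
    obtain ⟨y, hy, rfl⟩ := Finset.mem_image.1 hj
    have h1 := hImem y (hJI hy)
    refine ⟨D.symm_notMem h1, ?_, ?_⟩
    · simp only [hnode, D.right_inv h1]
    · simp only [hnode, D.right_inv h1]
      simp only [hJ, Finset.mem_sigma, Finset.mem_filter] at hy
      exact hy.1.2
  have hbnode : ∀ y ∈ I, ‖b (node y)‖ₑ ^ p = 2⁻¹ ^ levelSum e y.1 := by
    intro y hy
    have h1 := hImem y hy
    have h2 := D.symm_notMem h1
    have h3 : b (node y) = ((halfPow p (levelSum e y.1) : ℝ) : 𝕜) := by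
      simp only [hb, hnode, D.right_inv h1, h2, not_false_eq_true, and_self, if_true]
    rw [h3, ← enorm_halfPow hp0, ← ofReal_norm, ← ofReal_norm, RCLike.norm_ofReal,
      Real.norm_eq_abs]
  refine ⟨b, I.image node, J.image node, ?_, ?_, ?_, ?_⟩
  · intro j hj
    simp only [hb]
    rw [if_neg]
    rintro ⟨hjS, hjN⟩
    refine hj (Finset.mem_image.2 ⟨⟨(E j).2.1, (E j).2.2⟩, ?_, ?_⟩)
    · have h1 := D.map_mem hjS
      simp only [hI, Finset.mem_sigma, Finset.mem_range]
      exact ⟨by have := h1.1; omega, h1.2⟩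
    · simp only [hnode, ← hjN]
      exact D.left_inv hjS
  · have hd : ∀ j, differ 𝕜 (glueParent e S par E) (glueWeight p e S w E) b j =
        if j = E.symm (N, 0, 0) then 1 else 0 := by
      have hroot : ((N, 0, 0) : ℕ × ℕ × ℕ) ∈ treeNodes e := by
        simp [treeNodes]
      intro j
      rw [differ_apply]
      by_cases hjS : j ∈ S
      · have h1 : j ≠ E.symm (N, 0, 0) := fun h => D.symm_notMem hroot (h ▸ hjS)
        have h2 : ((glueWeight p e S w E j : ℝ) : 𝕜) * b (glueParent e S par E j) = 0 := by
          by_cases hw : w j = 0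
          · simp [glueWeight, hjS, hw]
          · have := D.mem j hjS hw
            simp [hb, glueParent, hjS, this]
        rw [h2, if_neg h1]
        simp [hb, hjS]
      · have hpar := D.parent_notMem hjS
        have hmp := D.map_parent hjS
        by_cases hjN : (E j).1 = N
        · have hbj : b j = ((halfPow p (levelSum e (E j).2.1) : ℝ) : 𝕜) := by
            simp only [hb]; rw [if_pos ⟨hjS, hjN⟩]
          have hbp : b (glueParent e S par E j) =
              ((halfPow p (levelSum e ((E j).2.1 - 1)) : ℝ) : 𝕜) := by
            simp only [hb]; rw [if_pos ⟨hpar, by rw [hmp]; exact hjN⟩, hmp]; rfl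
          by_cases h0 : (E j).2.1 = 0
          · have hx := (D.map_mem hjS).2
            rw [h0, levelSum_zero, pow_zero, Nat.lt_one_iff] at hx
            have hEj : E j = (N, 0, 0) := Prod.ext hjN (Prod.ext h0 hx)
            rw [if_pos (by rw [← hEj, D.left_inv hjS]), hbj, glueWeight, if_neg hjS, if_pos h0,
              h0, levelSum_zero, halfPow_zero]
            simp
          · have hne : j ≠ E.symm (N, 0, 0) := by
              intro h
              apply h0
              rw [h, D.right_inv hroot]
            have hl : (E j).2.1 = (E j).2.1 - 1 + 1 := by omega
            rw [if_neg hne, hbj, hbp, glueWeight, if_neg hjS, if_neg h0, hl, levelSum_succ,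
              halfPow_add, Nat.add_sub_cancel]
            push_cast
            ring
        · have hne : j ≠ E.symm (N, 0, 0) := by
            intro h
            apply hjN
            rw [h, D.right_inv hroot]
          have hbj : b j = 0 := by simp only [hb]; rw [if_neg fun h => hjN h.2]
          have hbp : b (glueParent e S par E j) = 0 := by
            simp only [hb]; rw [if_neg]; rintro ⟨-, h⟩; rw [hmp] at h; exact hjN h
          rw [hbj, hbp, if_neg hne]; simp
    rw [pSum, tsum_eq_single (E.symm (N, 0, 0))]
    · rw [hd, if_pos rfl]; simp
    · intro j hj
      rw [hd, if_neg hj]; simp [hp0]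
  · refine (Finset.card_le_card (Finset.image_subset_image hJI)).trans
      (Finset.card_image_le.trans ?_)
    rw [hI, Finset.card_sigma]
    simp only [Finset.card_range]
    exact sum_two_pow_levelSum_le D.one_le N
  · have hval : ∀ j ∈ J.image node,
        differ 𝕜 (glueParent e S par E) (glueWeight p e S w E)
          (fun j => if j ∈ J.image node then b j else 0) j = b j := by
      intro j hj
      obtain ⟨hjS, hjN, hev⟩ := hmemJ j hj
      rw [differ_apply, if_pos hj]
      by_cases h0 : (E j).2.1 = 0
      · rw [glueWeight, if_neg hjS, if_pos h0]; simp
      · rw [if_neg, mul_zero, sub_zero]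
        intro hpj
        have h3 := (hmemJ _ hpj).2.2
        rw [D.map_parent hjS, treeParent] at h3
        simp only at h3
        rw [Nat.even_sub (by omega)] at h3
        simp [hev] at h3
    have hcard : ((N : ℝ) + 1) / 2 ≤ (((Finset.range (N + 1)).filter Even).card : ℝ) := by
      have h1 : (Finset.range (N / 2 + 1)).card ≤ ((Finset.range (N + 1)).filter Even).card := by
        refine Finset.card_le_card_of_injOn (fun i => 2 * i) ?_ ?_
        · intro i hi
          simp only [Finset.coe_range, Set.mem_Iio] at hi
          simp only [Finset.coe_filter, Finset.mem_range, Set.mem_ofPred_eq, even_two,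
            Even.mul_right, and_true]
          omega
        · intro i _ j _ hij
          simpa using hij
      rw [Finset.card_range] at h1
      have h2 : N + 1 ≤ 2 * ((Finset.range (N + 1)).filter Even).card := by omega
      have h3 : (N : ℝ) + 1 ≤ 2 * (((Finset.range (N + 1)).filter Even).card : ℝ) := by
        exact_mod_cast h2
      linarith
    calc ENNReal.ofReal (((N : ℝ) + 1) / 2)
        ≤ ENNReal.ofReal (((Finset.range (N + 1)).filter Even).card : ℝ) :=
          ENNReal.ofReal_le_ofReal hcard
      _ = ∑ l ∈ (Finset.range (N + 1)).filter Even, (1 : ℝ≥0∞) := by simp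
      _ = ∑ y ∈ J, 2⁻¹ ^ levelSum e y.1 := by
          rw [hJ, Finset.sum_sigma]
          refine Finset.sum_congr rfl fun l _ => ?_
          simp only
          rw [Finset.sum_const, Finset.card_range, nsmul_eq_mul]
          push_cast
          rw [← mul_pow, ENNReal.mul_inv_cancel (by simp) (by simp), one_pow]
      _ = ∑ j ∈ J.image node, ‖b j‖ₑ ^ p := by
          rw [Finset.sum_image (hinj.mono (by exact_mod_cast hJI))]
          exact Finset.sum_congr rfl fun y hy => (hbnode y (hJI hy)).symm
      _ = ∑ j ∈ J.image node, ‖differ 𝕜 (glueParent e S par E) (glueWeight p e S w E)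
            (fun j => if j ∈ J.image node then b j else 0) j‖ₑ ^ p :=
          Finset.sum_congr rfl fun j hj => by rw [hval j hj]
      _ ≤ _ := ENNReal.sum_le_tsum _

/-- The complement of `S` carries a disjoint union of finite trees. -/
lemma exists_partialEquiv_treeNodes (e : ℕ → ℕ) {S : Set ℕ} (hS : Sᶜ.Infinite) :
    ∃ E : PartialEquiv ℕ (ℕ × ℕ × ℕ), E.source = Sᶜ ∧ E.target = treeNodes e := by
  classical
  have hinf : (treeNodes e).Infinite := by
    refine Set.infinite_of_injective_forall_mem (f := fun N : ℕ => ((N, 0, 0) : ℕ × ℕ × ℕ)) ?_ ?_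
    · intro a b h
      simpa using h
    · intro N
      simp [treeNodes]
  have := hS.to_subtype
  have := hinf.to_subtype
  obtain ⟨φ⟩ := nonempty_equiv_of_countable (α := ↥Sᶜ) (β := treeNodes e)
  refine ⟨{
    toFun := fun j => if h : j ∈ Sᶜ then φ ⟨j, h⟩ else (0, 0, 0)
    invFun := fun x => if h : x ∈ treeNodes e then φ.symm ⟨x, h⟩ else 0
    source := Sᶜ
    target := treeNodes e
    map_source' := ?_
    map_target' := ?_
    left_inv' := ?_
    right_inv' := ?_ }, rfl, rfl⟩
  · intro j hj
    rw [dif_pos hj]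
    exact (φ ⟨j, hj⟩).2
  · intro x hx
    rw [dif_pos hx]
    exact (φ.symm ⟨x, hx⟩).2
  · intro j hj
    rw [dif_pos hj, dif_pos (φ ⟨j, hj⟩).2]
    simp
  · intro x hx
    rw [dif_pos hx, dif_pos (φ.symm ⟨x, hx⟩).2]
    simp

/-! ### Cutting edges without changing the span. -/

open Classical in
/-- The weights of the edges below the nodes of `S`; the other edges are cut. -/
noncomputable def cutWeight (S : Set ℕ) (w : ℕ → ℝ) (j : ℕ) : ℝ := if j ∈ S then w j else 0

section Span

variable {𝕜 : Type*} [RCLike 𝕜] {par : ℕ → ℕ} {w : ℕ → ℝ} {S : Set ℕ}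

/-- Nodes outside `S` have no children in `S` with a nonzero weight, so their cut vectors are unit
vectors. Adding those of the children of `k` outside `S` removes exactly the edges that are cut. -/
lemma differ_single_add_sum (hS : ∀ j ∈ S, w j ≠ 0 → par j ∈ S) {k : ℕ}
    (hfin : {c | c ∉ S ∧ par c = k ∧ w c ≠ 0}.Finite) :
    differ 𝕜 par w (Pi.single k 1) + ∑ c ∈ hfin.toFinset,
      (w c : 𝕜) • differ 𝕜 par (cutWeight S w) (Pi.single c 1) =
      differ 𝕜 par (cutWeight S w) (Pi.single k 1) := by
  have hsingle : ∀ c ∉ S, differ 𝕜 par (cutWeight S w) (Pi.single c 1) = Pi.single c 1 := by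
    intro c hc
    ext j
    rw [differ_apply, cutWeight]
    split_ifs with hj
    · by_cases hw : w j = 0
      · simp [hw]
      · have h1 : par j ≠ c := fun h => hc (h ▸ hS j hj hw)
        simp [Pi.single_apply, h1]
    · simp
  have hsum : ∑ c ∈ hfin.toFinset, (w c : 𝕜) • differ 𝕜 par (cutWeight S w) (Pi.single c 1) =
      ∑ c ∈ hfin.toFinset, (w c : 𝕜) • (Pi.single c 1 : ℕ → 𝕜) :=
    Finset.sum_congr rfl fun c hc => by
      rw [hsingle c]
      simp only [Set.Finite.mem_toFinset] at hc
      exact hc.1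
  rw [hsum]
  ext j
  have h2 : (∑ c ∈ hfin.toFinset, (w c : 𝕜) • (Pi.single c 1 : ℕ → 𝕜)) j =
      if j ∈ hfin.toFinset then (w j : 𝕜) else 0 := by
    simp only [Finset.sum_apply, Pi.smul_apply, Pi.single_apply, smul_eq_mul, mul_ite, mul_one,
      mul_zero, Finset.sum_ite_eq]
  rw [Pi.add_apply, h2]
  simp only [differ_apply, cutWeight, Set.Finite.mem_toFinset, Set.mem_ofPred_eq]
  by_cases hj : j ∈ S
  · simp [hj]
  · by_cases hp : par j = k
    · by_cases hw : w j = 0 <;> simp [hj, hp, hw]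
    · simp [hj, hp, Pi.single_apply]

/-- If the nodes outside `S` have finitely many children outside `S`, and the chains of such nodes
are bounded, then cutting the edges above the nodes outside `S` does not change the linear span. -/
lemma span_differ_eq (hS : ∀ j ∈ S, w j ≠ 0 → par j ∈ S)
    (hfin : ∀ k, {c | c ∉ S ∧ par c = k ∧ w c ≠ 0}.Finite) (rk : ℕ → ℕ)
    (hrk : ∀ c ∉ S, w c ≠ 0 → par c ∉ S → rk c < rk (par c)) :
    Submodule.span 𝕜 (Set.range fun k => differ 𝕜 par w (Pi.single k 1)) =
      Submodule.span 𝕜 (Set.range fun k => differ 𝕜 par (cutWeight S w) (Pi.single k 1)) := by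
  apply le_antisymm
  · rw [Submodule.span_le]
    rintro _ ⟨k, rfl⟩
    have h1 := differ_single_add_sum (𝕜 := 𝕜) hS (hfin k)
    simp only [SetLike.mem_coe]
    rw [← eq_sub_iff_add_eq] at h1
    rw [h1]
    refine Submodule.sub_mem _ (Submodule.subset_span ⟨k, rfl⟩) (Submodule.sum_mem _ fun c _ =>
      Submodule.smul_mem _ _ (Submodule.subset_span ⟨c, rfl⟩))
  · rw [Submodule.span_le]
    -- Elimination from the lower ends of the chains outside `S`: the children have smaller rank, so
    -- their cut vectors are already in the span.
    have hout : ∀ n, ∀ k ∉ S, rk k = n → differ 𝕜 par (cutWeight S w) (Pi.single k 1) ∈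
        Submodule.span 𝕜 (Set.range fun k => differ 𝕜 par w (Pi.single k 1)) := by
      intro n
      induction n using Nat.strong_induction_on with
      | _ n ih =>
        intro k hk hn
        rw [← differ_single_add_sum (𝕜 := 𝕜) hS (hfin k)]
        refine Submodule.add_mem _ (Submodule.subset_span ⟨k, rfl⟩) (Submodule.sum_mem _ ?_)
        intro c hc
        simp only [Set.Finite.mem_toFinset, Set.mem_ofPred_eq] at hc
        obtain ⟨hcS, rfl, hw⟩ := hc
        exact Submodule.smul_mem _ _ (ih _ (hn ▸ hrk c hcS hw hk) c hcS rfl)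
    rintro _ ⟨k, rfl⟩
    simp only [SetLike.mem_coe]
    rw [← differ_single_add_sum (𝕜 := 𝕜) hS (hfin k)]
    refine Submodule.add_mem _ (Submodule.subset_span ⟨k, rfl⟩) (Submodule.sum_mem _ ?_)
    intro c hc
    simp only [Set.Finite.mem_toFinset, Set.mem_ofPred_eq] at hc
    exact Submodule.smul_mem _ _ (hout _ c hc.1 rfl)

end Span

section ClosedSpan

variable {𝕜 Y : Type*} [RCLike 𝕜] [AddCommGroup Y] [Module 𝕜 Y] [Norm Y]

lemma subset_closedSpan (s : Set Y) : s ⊆ closedSpan 𝕜 s := by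
  intro x hx
  simp only [closedSpan, SetLike.mem_coe, Submodule.mem_sInf]
  exact fun V hV => hV.1 hx

lemma closedSpan_mono_span {s t : Set Y} (h : s ⊆ Submodule.span 𝕜 t) :
    closedSpan 𝕜 s ≤ closedSpan 𝕜 t := by
  refine le_sInf fun V hV => sInf_le ⟨?_, hV.2⟩
  exact h.trans (Submodule.span_le.2 hV.1)

end ClosedSpan

/-- A criterion for the existence of an almost greedy basis with prescribed growth. -/
theorem GlueData.hasAlmostGreedyBasisWithGrowth
    {𝕜 Y : Type*} [RCLike 𝕜] [AddCommGroup Y] [Module 𝕜 Y] [Norm Y]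
    {p : ℝ} (hp0 : 0 < p) (hp1 : p ≤ 1) {e : ℕ → ℕ} {S : Set ℕ}
    {par : ℕ → ℕ} {w : ℕ → ℝ} {dep : ℕ → ℕ} {E : PartialEquiv ℕ (ℕ × ℕ × ℕ)}
    (D : GlueData p e S par w dep E) (he : Monotone e) {a : ℝ}
    (hup : ∃ C : ℝ, 0 < C ∧ ∀ m : ℕ, 2 ≤ m →
      massBound e m ≤ ENNReal.ofReal (C * Real.log m ^ (a * p)))
    (hlow : ∃ c : ℝ, 0 < c ∧ ∀ m : ℕ, 2 ≤ m → ∃ N : ℕ, 2 ^ (levelSum e N + 1) ≤ m ∧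
        c * Real.log m ^ (a * p) ≤ ((N : ℝ) + 1) / 2)
    (G : Y →ₗ[𝕜] (ℕ → 𝕜)) {K : ℝ} (hK : 0 < K) (hnn : ∀ f : Y, 0 ≤ ‖f‖)
    (hinj : Function.Injective G)
    (h1 : ∀ f, pSum p (G f) ≤ ENNReal.ofReal (K * ‖f‖ ^ p))
    (h2 : ∀ f, ENNReal.ofReal (‖f‖ ^ p) ≤ ENNReal.ofReal K * pSum p (G f))
    (u : ℕ → Y) (hu : closedSpan 𝕜 (Set.range u) = ⊤)
    (hspan : Submodule.span 𝕜 (Set.range fun k => G (u k)) =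
      Submodule.span 𝕜 (Set.range fun k => differ 𝕜 par (cutWeight S w) (Pi.single k 1))) :
    HasAlmostGreedyBasisWithGrowth 𝕜 Y a := by
  have hcut : ∀ x : ℕ → 𝕜, differ 𝕜 par (cutWeight S w) x =
      differ 𝕜 (glueParent e S par E) (cutWeight S (glueWeight p e S w E)) x := by
    intro x
    ext j
    by_cases hj : j ∈ S <;> simp [cutWeight, glueParent, glueWeight, hj]
  -- The glued finite trees also have bounded chains, so their edges can be put in place of the cut
  -- ones: both forests have the same fully cut version.
  have hspan' : Submodule.span 𝕜 (Set.range fun k => G (u k)) = Submodule.span 𝕜 (Set.range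
      fun k => differ 𝕜 (glueParent e S par E) (glueWeight p e S w E) (Pi.single k 1)) := by
    rw [hspan, span_differ_eq (S := S) ?_ D.finite_children (fun j => (E j).1 - (E j).2.1)
      (fun c hc hw _ => D.rank_lt hc hw)]
    · simp only [hcut]
    · intro j hj hw
      have hw' : w j ≠ 0 := by simpa [glueWeight, hj] using hw
      rw [glueParent, if_pos hj]
      exact D.mem j hj hw'
  have hmap : ∀ s : ℕ → Y, Submodule.span 𝕜 (Set.range fun k => G (s k)) =
      (Submodule.span 𝕜 (Set.range s)).map G := by
    intro s
    rw [Submodule.map_span, ← Set.range_comp]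
    rfl
  have hex : ∀ k, ∃ y : Y, G y =
      differ 𝕜 (glueParent e S par E) (glueWeight p e S w E) (Pi.single k 1) := by
    intro k
    have h3 : differ 𝕜 (glueParent e S par E) (glueWeight p e S w E) (Pi.single k 1) ∈
        (Submodule.span 𝕜 (Set.range u)).map G := by
      rw [← hmap, hspan']
      exact Submodule.subset_span ⟨k, rfl⟩
    obtain ⟨y, -, hy⟩ := h3
    exact ⟨y, hy⟩
  choose v hv using hex
  have hclosed : closedSpan 𝕜 (Set.range v) = ⊤ := by
    rw [eq_top_iff, ← hu]
    apply closedSpan_mono_span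
    rintro _ ⟨k, rfl⟩
    have h3 : G (u k) ∈ (Submodule.span 𝕜 (Set.range v)).map G := by
      rw [← hmap]
      simp only [hv]
      rw [← hspan']
      exact Submodule.subset_span ⟨k, rfl⟩
    obtain ⟨y, hy, hyk⟩ := h3
    rwa [← hinj hyk]
  have M : IsForestModel p (glueParent e S par E) (glueWeight p e S w E) G K v :=
    ⟨hK, hnn, hinj, h1, h2, hv, hclosed⟩
  refine M.hasAlmostGreedyBasisWithGrowth hp0 hp1 (D.isForest hp0) D.isDepth he
    (D.mass_le_pow hp0) hup ?_
  obtain ⟨c, hc, hlow⟩ := hlow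
  refine ⟨c, hc, fun m hm => ?_⟩
  obtain ⟨N, hN, hcN⟩ := hlow m hm
  obtain ⟨b, T, A, hT, hb, hA, hR⟩ := D.exists_large_projection 𝕜 hp0 N
  exact ⟨b, T, A, hT, hb, hA.trans hN, (ENNReal.ofReal_le_ofReal hcN).trans hR⟩

/-! ### Coarsening an infinite rooted tree. -/

/-- An infinite weighted tree on `ℕ` with root `0`, in which the parent of a node precedes it. -/
structure IsRootedTree (p : ℝ) (par : ℕ → ℕ) (w : ℕ → ℝ) (dep : ℕ → ℕ) : Prop
    extends IsForest p par w where
  par_lt : ∀ j, j ≠ 0 → par j < j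
  weight_zero : w 0 = 0
  depth_zero : dep 0 = 0
  depth_succ : ∀ j, j ≠ 0 → dep j = dep (par j) + 1
  finite_children : ∀ k, {c | par c = k}.Finite
  exists_child : ∀ k, ∃ c, c ≠ 0 ∧ par c = k

lemma IsRootedTree.isDepth {p : ℝ} {par : ℕ → ℕ} {w : ℕ → ℝ} {dep : ℕ → ℕ}
    (h : IsRootedTree p par w dep) : IsDepth par w dep := fun j hj =>
  h.depth_succ j fun h0 => hj (h0 ▸ h.weight_zero)

section Coarsen

variable {par : ℕ → ℕ}

open Classical in
/-- The nearest proper ancestor of `j` that belongs to `S`. -/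
noncomputable def nearestAncestor (hlt : ∀ j, j ≠ 0 → par j < j) (S : Set ℕ) (j : ℕ) : ℕ :=
  if hj : j = 0 then 0
  else
    have : par j < j := hlt j hj
    if par j ∈ S then par j else nearestAncestor hlt S (par j)
termination_by j

open Classical in
/-- The product of the weights along the path to the nearest proper ancestor in `S`. -/
noncomputable def pathWeight (hlt : ∀ j, j ≠ 0 → par j < j) (S : Set ℕ) (w : ℕ → ℝ) (j : ℕ) : ℝ :=
  if hj : j = 0 then 0
  else
    have : par j < j := hlt j hj
    if par j ∈ S then w j else w j * pathWeight hlt S w (par j)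
termination_by j

variable {hlt : ∀ j, j ≠ 0 → par j < j} {S : Set ℕ} {w : ℕ → ℝ}

lemma nearestAncestor_of_mem {j : ℕ} (hj : j ≠ 0) (h : par j ∈ S) :
    nearestAncestor hlt S j = par j := by
  rw [nearestAncestor, dif_neg hj, if_pos h]

lemma nearestAncestor_of_notMem {j : ℕ} (hj : j ≠ 0) (h : par j ∉ S) :
    nearestAncestor hlt S j = nearestAncestor hlt S (par j) := by
  rw [nearestAncestor, dif_neg hj, if_neg h]

lemma pathWeight_zero : pathWeight hlt S w 0 = 0 := by
  rw [pathWeight, dif_pos rfl]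

lemma pathWeight_of_mem {j : ℕ} (hj : j ≠ 0) (h : par j ∈ S) :
    pathWeight hlt S w j = w j := by
  rw [pathWeight, dif_neg hj, if_pos h]

lemma pathWeight_of_notMem {j : ℕ} (hj : j ≠ 0) (h : par j ∉ S) :
    pathWeight hlt S w j = w j * pathWeight hlt S w (par j) := by
  rw [pathWeight, dif_neg hj, if_neg h]

/-- Induction along the path from a node to its nearest proper ancestor in `S`. -/
lemma nearestAncestor_induction (hlt : ∀ j, j ≠ 0 → par j < j) (h0 : 0 ∈ S) {P : ℕ → Prop}
    (hmem : ∀ j, j ≠ 0 → par j ∈ S → P j)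
    (hnot : ∀ j, j ≠ 0 → par j ∉ S → P (par j) → P j) (j : ℕ) (hj : j ≠ 0) : P j := by
  induction j using Nat.strong_induction_on with
  | _ j ih =>
    by_cases h : par j ∈ S
    · exact hmem j hj h
    · exact hnot j hj h (ih _ (hlt j hj) fun h' => h (h' ▸ h0))

lemma nearestAncestor_mem (h0 : 0 ∈ S) (j : ℕ) (hj : j ≠ 0) : nearestAncestor hlt S j ∈ S := by
  refine nearestAncestor_induction (P := fun j => nearestAncestor hlt S j ∈ S) hlt h0 ?_ ?_ j hj
  · intro j hj h
    rwa [nearestAncestor_of_mem hj h]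
  · intro j hj h ih
    rwa [nearestAncestor_of_notMem hj h]

end Coarsen

open Classical in
/-- Conservation of mass: what reaches `S` comes from the sources `ψ` and from `S` itself. -/
lemma IsRootedTree.tsum_flow_le {p : ℝ} {par : ℕ → ℕ} {w : ℕ → ℝ} {dep : ℕ → ℕ}
    (h : IsRootedTree p par w dep) (hp0 : 0 < p) (S : Set ℕ) (μ φ ψ : ℕ → ℝ≥0∞)
    (hfin : ∀ j, μ j ≠ ∞)
    (hμ : ∀ j, μ j ≤ ψ j + edgeMass p w j * (if par j ∈ S then φ (par j) else μ (par j))) :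
    ∑' j, S.indicator μ j ≤ ∑' j, ψ j + ∑' k, S.indicator φ k := by
  refine ENNReal.tsum_le_of_sum_range_le fun n => ?_
  -- The mass off `S` is truncated below `n` so that it is finite and can be cancelled. Parents
  -- precede their children, so nothing that reaches the first `n` nodes is lost.
  set g : ℕ → ℝ≥0∞ := fun k => S.indicator φ k + (if k < n then Sᶜ.indicator μ k else 0) with hg
  have hgs : ∑' k, g k = ∑' k, S.indicator φ k + ∑ k ∈ Finset.range n, Sᶜ.indicator μ k := by
    rw [hg, ENNReal.tsum_add]
    congr 1
    rw [tsum_eq_sum (s := Finset.range n)]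
    · exact Finset.sum_congr rfl fun k hk => by rw [if_pos (Finset.mem_range.1 hk)]
    · intro k hk
      rw [if_neg (by simpa using hk)]
  have hc : ∑ k ∈ Finset.range n, Sᶜ.indicator μ k ≠ ∞ := by
    refine ENNReal.sum_ne_top.2 fun k _ => ?_
    rw [Set.indicator_apply]
    split_ifs
    exacts [hfin k, ENNReal.zero_ne_top]
  rw [← ENNReal.add_le_add_iff_right hc, add_assoc, ← hgs, ← Finset.sum_add_distrib]
  calc ∑ j ∈ Finset.range n, (S.indicator μ j + Sᶜ.indicator μ j)
      ≤ ∑ j ∈ Finset.range n, (ψ j + edgeMass p w j * g (par j)) := by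
        refine Finset.sum_le_sum fun j hj => ?_
        have h1 : S.indicator μ j + Sᶜ.indicator μ j = μ j := by
          by_cases hj : j ∈ S <;> simp [hj]
        rw [h1]
        by_cases hj0 : j = 0
        · refine (hμ j).trans ?_
          rw [edgeMass_eq_zero hp0 (by rw [hj0, h.weight_zero]), zero_mul, zero_mul]
        · refine (hμ j).trans ?_
          gcongr
          have h2 : par j < n := (h.par_lt j hj0).trans (Finset.mem_range.1 hj)
          by_cases hS : par j ∈ S <;> simp [hg, hS, h2]
    _ ≤ ∑' j, (ψ j + edgeMass p w j * g (par j)) := ENNReal.sum_le_tsum _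
    _ ≤ ∑' j, ψ j + ∑' k, g k := by
        rw [ENNReal.tsum_add]
        exact add_le_add le_rfl (h.tsum_mass_le g)

section Mix

variable {𝕜 : Type*} [RCLike 𝕜] {p : ℝ} {par : ℕ → ℕ} {w : ℕ → ℝ} {dep : ℕ → ℕ} {S : Set ℕ}

open Classical in
/-- The nodes of `S` are attached to their nearest proper ancestors in `S`. -/
noncomputable def mixParent (hlt : ∀ j, j ≠ 0 → par j < j) (S : Set ℕ) (j : ℕ) : ℕ :=
  if j ∈ S then nearestAncestor hlt S j else par j

open Classical in
/-- The weights that go with `mixParent`. -/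
noncomputable def mixWeight (hlt : ∀ j, j ≠ 0 → par j < j) (S : Set ℕ) (w : ℕ → ℝ) (j : ℕ) : ℝ :=
  if j ∈ S then pathWeight hlt S w j else w j

-- Along a path that avoids `S`, the coarse difference obeys the same recursion as a coefficient,
-- with the fine differences as sources, and it restarts whenever the parent is in `S`.
open Classical in
lemma IsRootedTree.differ_nearestAncestor (h : IsRootedTree p par w dep) (a : ℕ → 𝕜) (j : ℕ) :
    differ 𝕜 (nearestAncestor h.par_lt S) (pathWeight h.par_lt S w) a j =
      differ 𝕜 par w a j + (w j : 𝕜) * (if par j ∈ S then 0 else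
        differ 𝕜 (nearestAncestor h.par_lt S) (pathWeight h.par_lt S w) a (par j)) := by
  by_cases hj : j = 0
  · subst hj
    simp [h.weight_zero, pathWeight_zero]
  · split_ifs with hS
    · simp [nearestAncestor_of_mem hj hS, pathWeight_of_mem hj hS]
    · simp only [differ_apply, nearestAncestor_of_notMem hj hS, pathWeight_of_notMem hj hS]
      push_cast
      ring

open Classical in
/-- Passing to the coarser tree on `S` gives an equivalent quasi-norm. -/
lemma IsRootedTree.pSum_mix (h : IsRootedTree p par w dep) (hp0 : 0 < p) (hp1 : p ≤ 1)
    (a : ℕ → 𝕜) :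
    pSum p (differ 𝕜 (mixParent h.par_lt S) (mixWeight h.par_lt S w) a) ≤
        2 * pSum p (differ 𝕜 par w a) ∧
      pSum p (differ 𝕜 par w a) ≤
        2 * pSum p (differ 𝕜 (mixParent h.par_lt S) (mixWeight h.par_lt S w) a) := by
  set H := differ 𝕜 (nearestAncestor h.par_lt S) (pathWeight h.par_lt S w) a with hH
  set r : ℕ → 𝕜 := fun j => (w j : 𝕜) * (if par j ∈ S then 0 else H (par j)) with hr
  set R : ℕ → 𝕜 := S.indicator r with hR
  set f := differ 𝕜 par w a with hf
  set g := differ 𝕜 (mixParent h.par_lt S) (mixWeight h.par_lt S w) a with hg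
  have hHr : ∀ j, H j = f j + r j := fun j => h.differ_nearestAncestor a j
  have hgf : g = f + R := by
    ext j
    by_cases hj : j ∈ S
    · rw [Pi.add_apply, hR, Set.indicator_of_mem hj, ← hHr j]
      simp [hg, hH, mixParent, mixWeight, hj]
    · rw [Pi.add_apply, hR, Set.indicator_of_notMem hj, add_zero]
      simp [hg, hf, mixParent, mixWeight, hj]
  -- Only fine differences off `S` feed the correction `R`, and they reach `S` without gain of mass.
  -- Off `S` the fine and the mixed differences agree, so the same bound serves both inequalities.
  have hflow := h.tsum_flow_le hp0 S
    (fun j => if j ∈ S then ‖r j‖ₑ ^ p else ‖H j‖ₑ ^ p) (fun _ => 0)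
    (Sᶜ.indicator fun j => ‖f j‖ₑ ^ p)
    (fun j => by split_ifs <;> exact ENNReal.rpow_ne_top_of_nonneg hp0.le enorm_ne_top) (by
      intro j
      have h1 : ‖r j‖ₑ ^ p = edgeMass p w j *
          (if par j ∈ S then 0 else if par j ∈ S then ‖r (par j)‖ₑ ^ p else ‖H (par j)‖ₑ ^ p) := by
        rw [hr, enorm_rpow_ofReal_mul hp0]
        split_ifs <;> simp [hp0]
      rw [← h1]
      by_cases hj : j ∈ S
      · simp [hj]
      · simp only [hj, if_false, Set.mem_compl_iff, not_false_eq_true, Set.indicator_of_mem]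
        rw [hHr j]
        exact enorm_rpow_add_le hp0 hp1 _ _)
  have hRsum : pSum p R ≤ ∑' j, Sᶜ.indicator (fun j => ‖f j‖ₑ ^ p) j := by
    refine le_trans (ENNReal.tsum_le_tsum fun j => ?_) (hflow.trans (by simp))
    by_cases hj : j ∈ S <;> simp [hR, hj, hp0]
  constructor
  · calc pSum p g ≤ pSum p f + pSum p R := by rw [hgf]; exact pSum_add_le hp0 hp1 _ _
      _ ≤ pSum p f + pSum p f := by
          gcongr
          refine hRsum.trans (ENNReal.tsum_le_tsum fun j => Set.indicator_le_self _ _ _)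
      _ = 2 * pSum p f := (two_mul _).symm
  · have hfg : f = g - R := by rw [hgf, add_sub_cancel_right]
    calc pSum p f ≤ pSum p g + pSum p R := by
          conv_lhs => rw [hfg]
          exact pSum_sub_le hp0 hp1 _ _
      _ ≤ pSum p g + pSum p g := by
          gcongr
          refine hRsum.trans (ENNReal.tsum_le_tsum fun j => ?_)
          by_cases hj : j ∈ S
          · simp [hj]
          · simp [hj, hgf, hR]
      _ = 2 * pSum p g := (two_mul _).symm

end Mix

/-! ### Selected levels and the resulting coarse forest. -/

section Levels

variable {e : ℕ → ℕ}

open Classical in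
/-- The number of values of `levelSum e` below `n`. -/
noncomputable def levelCount (e : ℕ → ℕ) : ℕ → ℕ
  | 0 => 0
  | n + 1 => if n ∈ Set.range (levelSum e) then levelCount e n + 1 else levelCount e n

lemma levelSum_strictMono (he : ∀ i, 1 ≤ e i) : StrictMono (levelSum e) :=
  strictMono_nat_of_lt_succ fun l => by
    have := he l
    rw [levelSum_succ]
    omega

lemma notMem_range_levelSum (he : ∀ i, 1 ≤ e i) {l t : ℕ} (h0 : 0 < t) (ht : t < e l) :
    levelSum e l + t ∉ Set.range (levelSum e) := by
  rintro ⟨i, hi⟩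
  have h1 : l < i := (levelSum_strictMono he).lt_iff_lt.1 (by omega)
  have h2 := (levelSum_strictMono he).monotone (Nat.succ_le_of_lt h1)
  rw [Nat.succ_eq_add_one, levelSum_succ] at h2
  omega

lemma levelCount_levelSum (he : ∀ i, 1 ≤ e i) (l : ℕ) : levelCount e (levelSum e l) = l := by
  induction l with
  | zero => rfl
  | succ l ih =>
    have h1 : ∀ t, t + 1 ≤ e l → levelCount e (levelSum e l + (t + 1)) = l + 1 := by
      intro t
      induction t with
      | zero =>
        intro _
        rw [zero_add, levelCount, if_pos ⟨l, rfl⟩, ih]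
      | succ t iht =>
        intro ht
        rw [← add_assoc, levelCount, if_neg (notMem_range_levelSum he (by omega) (by omega))]
        exact iht (by omega)
    have h2 := he l
    have h3 := h1 (e l - 1) (by omega)
    rwa [Nat.sub_add_cancel h2, ← levelSum_succ] at h3

/-- `levelCount e n` indexes the first selected level at or below depth `n` in the tree, so the
difference of the two sides is the distance down to it. -/
lemma le_levelSum_levelCount (he : ∀ i, 1 ≤ e i) (n : ℕ) : n ≤ levelSum e (levelCount e n) := by
  induction n with
  | zero => exact Nat.zero_le _
  | succ n ih =>
    rw [levelCount]
    split_ifs with h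
    · have := he (levelCount e n)
      rw [levelSum_succ]
      omega
    · exact Nat.succ_le_of_lt (lt_of_le_of_ne ih fun h' => h ⟨_, h'.symm⟩)

end Levels

section CoarseTree

variable {p : ℝ} {par : ℕ → ℕ} {w : ℕ → ℝ} {dep : ℕ → ℕ} {e : ℕ → ℕ}

/-- The nodes whose depth is one of the numbers `levelSum e l`. -/
def coarseNodes (e : ℕ → ℕ) (dep : ℕ → ℕ) : Set ℕ := {j | dep j ∈ Set.range (levelSum e)}

namespace IsRootedTree

lemma zero_mem_coarseNodes (h : IsRootedTree p par w dep) : 0 ∈ coarseNodes e dep :=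
  ⟨0, by rw [h.depth_zero]; rfl⟩

/-- Since `e i ≥ 2`, a child of a selected node is never selected, and distinct nodes have distinct
children. -/
lemma infinite_compl_coarseNodes (h : IsRootedTree p par w dep) (he : ∀ i, 2 ≤ e i) :
    (coarseNodes e dep)ᶜ.Infinite := by
  by_cases hS : (coarseNodes e dep).Finite
  · exact hS.infinite_compl
  · choose c hc0 hc using h.exists_child
    refine Set.infinite_of_injOn_mapsTo (f := c) (s := coarseNodes e dep) ?_ ?_ hS
    · intro i _ j _ hij
      rw [← hc i, hij, hc]
    · rintro k ⟨l, hl⟩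
      change dep (c k) ∉ Set.range (levelSum e)
      rw [h.depth_succ _ (hc0 k), hc, ← hl]
      exact notMem_range_levelSum (fun i => one_le_two.trans (he i)) one_pos (he l)

/-- Exactly one selected level is crossed on the way down from the nearest selected ancestor. Hence
`levelCount e (dep j)` is the depth of a selected node in the coarse tree. -/
lemma levelCount_nearestAncestor (h : IsRootedTree p par w dep) (j : ℕ) (hj : j ≠ 0) :
    levelCount e (dep j) =
      levelCount e (dep (nearestAncestor h.par_lt (coarseNodes e dep) j)) + 1 := by
  refine nearestAncestor_induction (S := coarseNodes e dep) (P := fun j => levelCount e (dep j) =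
      levelCount e (dep (nearestAncestor h.par_lt (coarseNodes e dep) j)) + 1)
    h.par_lt h.zero_mem_coarseNodes ?_ ?_ j hj
  · intro j hj hS
    rw [nearestAncestor_of_mem hj hS, h.depth_succ j hj, levelCount,
      if_pos (show dep (par j) ∈ Set.range (levelSum e) from hS)]
  · intro j hj hS ih
    rw [nearestAncestor_of_notMem hj hS, h.depth_succ j hj, levelCount,
      if_neg (show dep (par j) ∉ Set.range (levelSum e) from hS), ih]

/-- Every edge on the path contributes a factor of at most one half; between consecutive selected
levels there are `e l` edges. -/
lemma edgeMass_pathWeight_le (h : IsRootedTree p par w dep) (hp0 : 0 < p) {S : Set ℕ} (h0 : 0 ∈ S)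
    (j : ℕ) (hj : j ≠ 0) : dep (nearestAncestor h.par_lt S j) ≤ dep j ∧
      edgeMass p (pathWeight h.par_lt S w) j ≤
        2⁻¹ ^ (dep j - dep (nearestAncestor h.par_lt S j)) := by
  refine nearestAncestor_induction (P := fun j => dep (nearestAncestor h.par_lt S j) ≤ dep j ∧
      edgeMass p (pathWeight h.par_lt S w) j ≤
        2⁻¹ ^ (dep j - dep (nearestAncestor h.par_lt S j))) h.par_lt h0 ?_ ?_ j hj
  · intro j hj hS
    rw [nearestAncestor_of_mem hj hS, h.depth_succ j hj, edgeMass, pathWeight_of_mem hj hS]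
    refine ⟨Nat.le_succ _, ?_⟩
    rw [Nat.add_sub_cancel_left, pow_one]
    exact h.mass_le_half j
  · intro j hj hS ih
    rw [nearestAncestor_of_notMem hj hS, h.depth_succ j hj, edgeMass, pathWeight_of_notMem hj hS]
    refine ⟨ih.1.trans (Nat.le_succ _), ?_⟩
    rw [Nat.sub_add_comm ih.1, pow_succ', enorm_mul, ENNReal.mul_rpow_of_nonneg _ _ hp0.le]
    exact mul_le_mul' (h.mass_le_half j) ih.2

-- Conservation of mass with a single unit placed at `k` and no other source: the path masses are
-- what reaches the next nodes of `S`.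
open Classical in
lemma tsum_children_pathWeight_le (h : IsRootedTree p par w dep) (hp0 : 0 < p) {S : Set ℕ}
    (k : ℕ) : ∑' j, S.indicator (fun j => if nearestAncestor h.par_lt S j = k then
      edgeMass p (pathWeight h.par_lt S w) j else 0) j ≤ 1 := by
  refine (h.tsum_flow_le hp0 S _ (fun i => if i = k then 1 else 0) (fun _ => 0) ?_ ?_).trans ?_
  · intro j
    split_ifs
    exacts [ENNReal.rpow_ne_top_of_nonneg hp0.le enorm_ne_top, ENNReal.zero_ne_top]
  · intro j
    rw [zero_add]
    by_cases hj : j = 0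
    · subst hj
      rw [edgeMass_eq_zero hp0 pathWeight_zero]
      simp
    by_cases hS : par j ∈ S
    · rw [if_pos hS, nearestAncestor_of_mem hj hS, edgeMass, pathWeight_of_mem hj hS]
      split_ifs <;> simp [edgeMass]
    · rw [if_neg hS, nearestAncestor_of_notMem hj hS, edgeMass, pathWeight_of_notMem hj hS,
        enorm_mul, ENNReal.mul_rpow_of_nonneg _ _ hp0.le]
      split_ifs <;> simp [edgeMass]
  · rw [tsum_zero, zero_add]
    refine le_trans (ENNReal.tsum_le_tsum fun i => ?_)
      (tsum_ite_eq k fun _ => (1 : ℝ≥0∞)).le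
    exact Set.indicator_le_self S (fun i => if i = k then (1 : ℝ≥0∞) else 0) i

lemma isPartialForest (h : IsRootedTree p par w dep) (hp0 : 0 < p) (he : ∀ i, 1 ≤ e i) :
    IsPartialForest p e (coarseNodes e dep) (mixParent h.par_lt (coarseNodes e dep))
      (mixWeight h.par_lt (coarseNodes e dep) w) (fun j => levelCount e (dep j)) := by
  have hne : ∀ j ∈ coarseNodes e dep, mixWeight h.par_lt (coarseNodes e dep) w j ≠ 0 → j ≠ 0 := by
    rintro j hj hw rfl
    rw [mixWeight, if_pos hj, pathWeight_zero] at hw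
    exact hw rfl
  constructor
  · intro j hj hw
    rw [mixParent, if_pos hj]
    exact nearestAncestor_mem h.zero_mem_coarseNodes j (hne j hj hw)
  · intro j hj hw
    rw [mixParent, if_pos hj]
    exact h.levelCount_nearestAncestor j (hne j hj hw)
  · intro j hj hw
    have hj0 := hne j hj hw
    have h1 := (h.edgeMass_pathWeight_le hp0 (h.zero_mem_coarseNodes (e := e)) j hj0).2
    have h2 := h.levelCount_nearestAncestor (e := e) j hj0
    obtain ⟨l, hl⟩ := hj
    obtain ⟨l', hl'⟩ := nearestAncestor_mem (hlt := h.par_lt)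
      (h.zero_mem_coarseNodes (e := e)) j hj0
    have hj : j ∈ coarseNodes e dep := ⟨l, hl⟩
    rw [edgeMass, mixWeight, if_pos hj, mixParent, if_pos hj]
    rw [← hl, ← hl', levelCount_levelSum he, levelCount_levelSum he] at h2
    rw [← hl, ← hl', h2, levelSum_succ, Nat.add_sub_cancel_left] at h1
    rw [← hl', levelCount_levelSum he]
    exact h1
  · intro k
    refine le_trans (le_of_eq (tsum_congr fun j => ?_))
      (h.tsum_children_pathWeight_le hp0 (S := coarseNodes e dep) k)
    by_cases hj : j ∈ coarseNodes e dep
    · simp only [Set.indicator_of_mem hj, edgeMass, mixParent, mixWeight, if_pos hj]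
    · simp only [Set.indicator_of_notMem hj]

/-- The rank of an unselected node is its distance down to the next selected level, which bounds the
chains of unselected nodes below it. -/
lemma span_differ_mix (𝕜 : Type*) [RCLike 𝕜] (h : IsRootedTree p par w dep)
    (he : ∀ i, 1 ≤ e i) :
    Submodule.span 𝕜 (Set.range fun k => differ 𝕜 (mixParent h.par_lt (coarseNodes e dep))
      (mixWeight h.par_lt (coarseNodes e dep) w) (Pi.single k 1)) =
    Submodule.span 𝕜 (Set.range fun k => differ 𝕜 (mixParent h.par_lt (coarseNodes e dep))
      (cutWeight (coarseNodes e dep) (mixWeight h.par_lt (coarseNodes e dep) w))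
      (Pi.single k 1)) := by
  refine span_differ_eq ?_ ?_ (fun k => levelSum e (levelCount e (dep k)) - dep k) ?_
  · intro j hj hw
    rw [mixParent, if_pos hj]
    refine nearestAncestor_mem h.zero_mem_coarseNodes j ?_
    rintro rfl
    rw [mixWeight, if_pos hj, pathWeight_zero] at hw
    exact hw rfl
  · intro k
    refine (h.finite_children k).subset ?_
    rintro c ⟨hc, hk, -⟩
    rwa [mixParent, if_neg hc] at hk
  · intro c hc _ hpc
    rw [mixParent, if_neg hc] at hpc ⊢
    have hc0 : c ≠ 0 := fun h0 => hc (h0 ▸ h.zero_mem_coarseNodes)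
    have h1 := le_levelSum_levelCount he (dep (par c))
    have h2 : dep (par c) ≠ levelSum e (levelCount e (dep (par c))) :=
      fun h' => hpc ⟨_, h'.symm⟩
    have h3 : levelCount e (dep (par c) + 1) = levelCount e (dep (par c)) := by
      rw [levelCount, if_neg (show dep (par c) ∉ Set.range (levelSum e) from hpc)]
    rw [h.depth_succ c hc0, h3]
    omega

end IsRootedTree

end CoarseTree

/-! ### The space `ℓ_p`. -/

section EllP

variable {𝕜 : Type*} [RCLike 𝕜] {p : ℝ}

/-- An element of `ℓ_p` as a sequence. -/
def ellpCoe (𝕜 : Type*) [RCLike 𝕜] (p : ℝ) : EllP 𝕜 p →ₗ[𝕜] (ℕ → 𝕜) where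
  toFun f := f
  map_add' f g := lp.coeFn_add f g
  map_smul' c f := lp.coeFn_smul c f

lemma ellpCoe_injective : Function.Injective (ellpCoe 𝕜 p) := fun _ _ h => lp.ext h

lemma ellpCoe_unit (j : ℕ) : ellpCoe 𝕜 p (ellpUnit 𝕜 p j) = Pi.single j 1 :=
  funext fun i => lp.single_apply (E := fun _ : ℕ => 𝕜) (ENNReal.ofReal p) j 1 i

lemma ellp_norm_nonneg (f : EllP 𝕜 p) : 0 ≤ ‖f‖ := lp.norm_nonneg' f

lemma pSum_ellpCoe (hp0 : 0 < p) (f : EllP 𝕜 p) :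
    pSum p (ellpCoe 𝕜 p f) = ENNReal.ofReal (‖f‖ ^ p) := by
  have hp : (ENNReal.ofReal p).toReal = p := ENNReal.toReal_ofReal hp0.le
  have h1 := lp.norm_rpow_eq_tsum (by rw [hp]; exact hp0) f
  have h2 := (lp.memℓp f).summable (by rw [hp]; exact hp0)
  rw [hp] at h1 h2
  rw [h1, ENNReal.ofReal_tsum_of_nonneg (fun _ => by positivity) h2]
  refine tsum_congr fun j => ?_
  rw [← ENNReal.ofReal_rpow_of_nonneg (norm_nonneg _) hp0.le, ofReal_norm]
  rfl

lemma closedSpan_ellpUnit (hp0 : 0 < p) :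
    closedSpan 𝕜 (Set.range (ellpUnit 𝕜 p)) = ⊤ := by
  rw [eq_top_iff]
  refine le_sInf fun V hV f _ => hV.2 f fun ε hε => ?_
  set y : ℕ → EllP 𝕜 p := fun n => ∑ i ∈ Finset.range n, ellpCoe 𝕜 p f i • ellpUnit 𝕜 p i with hy
  have hyV : ∀ n, y n ∈ V := fun n =>
    V.sum_mem fun i _ => V.smul_mem _ (hV.1 ⟨i, rfl⟩)
  have hpy : ∀ n, pSum p (ellpCoe 𝕜 p (f - y n)) = ∑' i, ‖ellpCoe 𝕜 p f (i + n)‖ₑ ^ p := by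
    intro n
    have h1 : ∀ j, ellpCoe 𝕜 p (f - y n) j = if j < n then 0 else ellpCoe 𝕜 p f j := by
      intro j
      have h2 : ellpCoe 𝕜 p (y n) j = if j < n then ellpCoe 𝕜 p f j else 0 := by
        simp only [hy, map_sum, map_smul, ellpCoe_unit, Finset.sum_apply, Pi.smul_apply,
          Pi.single_apply, smul_eq_mul, mul_ite, mul_one, mul_zero, Finset.sum_ite_eq,
          Finset.mem_range]
      rw [map_sub, Pi.sub_apply, h2]
      split_ifs <;> simp
    rw [pSum, ← ENNReal.summable.sum_add_tsum_nat_add' (k := n)]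
    rw [Finset.sum_eq_zero, zero_add]
    · exact tsum_congr fun i => by rw [h1, if_neg (by omega)]
    · intro i hi
      rw [h1, if_pos (Finset.mem_range.1 hi)]
      simp [hp0]
  have hfin : pSum p (ellpCoe 𝕜 p f) ≠ ∞ := by
    rw [pSum_ellpCoe hp0]; exact ENNReal.ofReal_ne_top
  have hlim := ENNReal.tendsto_sum_nat_add (fun j => ‖ellpCoe 𝕜 p f j‖ₑ ^ p) hfin
  have hεp : (0 : ℝ≥0∞) < ENNReal.ofReal (ε ^ p) := by
    rw [ENNReal.ofReal_pos]; positivity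
  obtain ⟨n, hn⟩ := (hlim.eventually (gt_mem_nhds hεp)).exists
  refine ⟨y n, hyV n, ?_⟩
  rw [← hpy, pSum_ellpCoe hp0, ENNReal.ofReal_lt_ofReal_iff (by positivity)] at hn
  exact (Real.rpow_lt_rpow_iff (ellp_norm_nonneg _) hε.le hp0).1 hn

end EllP

/-- Here `S` is empty: all nodes belong to the finite trees, and cutting every edge leaves the unit
vectors. -/
theorem ellp_hasAlmostGreedyBasisWithGrowth (𝕜 : Type*) [RCLike 𝕜] {p : ℝ} (hp0 : 0 < p)
    (hp1 : p ≤ 1) {a : ℝ} (ha0 : 0 < a) (ha1 : a ≤ 1 / p) :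
    HasAlmostGreedyBasisWithGrowth 𝕜 (EllP 𝕜 p) a := by
  obtain ⟨e, he, he2, hup, hlow⟩ := exists_branching_exponents (r := a * p) (by positivity)
    ((le_div_iff₀ hp0).1 ha1)
  obtain ⟨E, hE1, hE2⟩ := exists_partialEquiv_treeNodes e (S := ∅)
    (by rw [Set.compl_empty]; exact Set.infinite_univ)
  have D : GlueData p e ∅ id (fun _ => 0) (fun _ => 0) E :=
    { mem := fun j hj => absurd hj (Set.notMem_empty j)
      depth := fun j hj => absurd hj (Set.notMem_empty j)
      mass_le := fun j hj => absurd hj (Set.notMem_empty j)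
      sum_children_le := fun k => by simp
      one_le := fun i => one_le_two.trans (he2 i)
      source_eq := hE1
      target_eq := hE2 }
  refine D.hasAlmostGreedyBasisWithGrowth hp0 hp1 he hup hlow (ellpCoe 𝕜 p) one_pos
    ellp_norm_nonneg ellpCoe_injective (fun f => ?_) (fun f => ?_) (ellpUnit 𝕜 p)
    (closedSpan_ellpUnit hp0) ?_
  · rw [pSum_ellpCoe hp0, one_mul]
  · rw [pSum_ellpCoe hp0, ENNReal.ofReal_one, one_mul]
  · congr 2
    ext k j
    rw [ellpCoe_unit]
    simp [cutWeight]

/-! ### The tree of `𝕏_p(δ)`. -/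

section Tree

variable {d : ℕ → ℕ}

lemma lindenstraussSigma_succ (d : ℕ → ℕ) (k : ℕ) :
    lindenstraussSigma d (k + 1) = lindenstraussSigma d k + d k := by
  rw [lindenstraussSigma, lindenstraussSigma, Finset.sum_range_succ, add_assoc]

lemma lindenstraussSigma_strictMono (hd : ∀ n, 2 ≤ d n) : StrictMono (lindenstraussSigma d) :=
  strictMono_nat_of_lt_succ fun k => by
    have := hd k
    rw [lindenstraussSigma_succ]
    omega

lemma lt_lindenstraussSigma (hd : ∀ n, 2 ≤ d n) (k : ℕ) : k < lindenstraussSigma d k := by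
  induction k with
  | zero => simp [lindenstraussSigma]
  | succ k ih =>
    have := hd k
    rw [lindenstraussSigma_succ]
    omega

/-- The index `k` such that `e_j` occurs in `x_k` with a negative coefficient. -/
def lindenstraussParent (d : ℕ → ℕ) (j : ℕ) : ℕ :=
  Nat.findGreatest (fun k => lindenstraussSigma d k ≤ j) j

lemma lindenstraussParent_eq_iff (hd : ∀ n, 2 ≤ d n) {j k : ℕ} (hj : j ≠ 0) :
    lindenstraussParent d j = k ↔ lindenstraussSigma d k ≤ j ∧ j < lindenstraussSigma d (k + 1) := by
  have h1 : lindenstraussSigma d (lindenstraussParent d j) ≤ j :=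
    Nat.findGreatest_spec (P := fun k => lindenstraussSigma d k ≤ j) (Nat.zero_le j)
      (by simp [lindenstraussSigma]; omega)
  have h2 : j < lindenstraussSigma d (lindenstraussParent d j + 1) := by
    by_contra hcon
    push Not at hcon
    have h3 := lt_lindenstraussSigma hd (lindenstraussParent d j + 1)
    have h4 : lindenstraussParent d j + 1 ≤ lindenstraussParent d j :=
      Nat.le_findGreatest (P := fun k => lindenstraussSigma d k ≤ j) (h3.le.trans hcon) hcon
    omega
  constructor
  · rintro rfl
    exact ⟨h1, h2⟩
  · rintro ⟨h3, h4⟩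
    have hm := lindenstraussSigma_strictMono hd
    have h5 := hm.lt_iff_lt.1 (h1.trans_lt h4)
    have h6 := hm.lt_iff_lt.1 (h3.trans_lt h2)
    omega

lemma lindenstraussParent_lt (hd : ∀ n, 2 ≤ d n) (j : ℕ) (hj : j ≠ 0) :
    lindenstraussParent d j < j :=
  (lt_lindenstraussSigma hd _).trans_le ((lindenstraussParent_eq_iff hd hj).1 rfl).1

/-- The weight `d_k ^ (-1 / p)` of the edge from `k` to `j`. -/
noncomputable def lindenstraussWeight (p : ℝ) (d : ℕ → ℕ) (j : ℕ) : ℝ :=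
  if j = 0 then 0 else (d (lindenstraussParent d j) : ℝ) ^ (-(1 / p))

/-- The depth of a node below the root `0`. -/
def rootDepth {par : ℕ → ℕ} (hlt : ∀ j, j ≠ 0 → par j < j) (j : ℕ) : ℕ :=
  if hj : j = 0 then 0
  else
    have : par j < j := hlt j hj
    rootDepth hlt (par j) + 1
termination_by j

lemma edgeMass_lindenstraussWeight {p : ℝ} (hp0 : 0 < p) (hd : ∀ n, 2 ≤ d n) {j : ℕ}
    (hj : j ≠ 0) :
    edgeMass p (lindenstraussWeight p d) j = (d (lindenstraussParent d j) : ℝ≥0∞)⁻¹ := by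
  have h1 : 0 < d (lindenstraussParent d j) := by have := hd (lindenstraussParent d j); omega
  have h2 : (0 : ℝ) < d (lindenstraussParent d j) := by exact_mod_cast h1
  rw [edgeMass, lindenstraussWeight, if_neg hj, Real.rpow_neg h2.le, ← Real.inv_rpow h2.le,
    enorm_rpow_inv hp0 (by positivity), ENNReal.ofReal_inv_of_pos h2, ENNReal.ofReal_natCast]

lemma isRootedTree_lindenstrauss {p : ℝ} (hp0 : 0 < p) (hd : ∀ n, 2 ≤ d n) :
    IsRootedTree p (lindenstraussParent d) (lindenstraussWeight p d)
      (rootDepth (lindenstraussParent_lt hd)) where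
  mass_le_half j := by
    by_cases hj : j = 0
    · rw [edgeMass_eq_zero hp0 (by rw [lindenstraussWeight, if_pos hj])]; exact zero_le
    · rw [edgeMass_lindenstraussWeight hp0 hd hj]
      exact ENNReal.inv_le_inv.2 (by exact_mod_cast hd _)
  sum_children_le k := by
    have hkey : ∀ j, (if lindenstraussParent d j = k then
        edgeMass p (lindenstraussWeight p d) j else 0) ≠ 0 →
        j ≠ 0 ∧ lindenstraussParent d j = k := by
      intro j hj
      have h1 : lindenstraussParent d j = k := by
        by_contra h; simp [h] at hj
      refine ⟨?_, h1⟩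
      rintro rfl
      rw [if_pos h1, edgeMass_eq_zero hp0 (by rw [lindenstraussWeight, if_pos rfl])] at hj
      exact hj rfl
    have hdk : d k ≠ 0 := by have := hd k; omega
    calc _ ≤ (d k : ℝ≥0∞) * (d k : ℝ≥0∞)⁻¹ := by
          refine tsum_le_of_injOn_support _ (fun j => j - lindenstraussSigma d k) _ _ ?_ ?_ ?_
          · intro j hj
            obtain ⟨h0, h1⟩ := hkey j hj
            have h2 := (lindenstraussParent_eq_iff hd h0).1 h1
            rw [lindenstraussSigma_succ] at h2
            omega
          · intro i j hi hj hij
            obtain ⟨h0, h1⟩ := hkey i hi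
            obtain ⟨h0', h1'⟩ := hkey j hj
            have h2 := (lindenstraussParent_eq_iff hd h0).1 h1
            have h3 := (lindenstraussParent_eq_iff hd h0').1 h1'
            omega
          · intro j hj
            obtain ⟨h0, h1⟩ := hkey j hj
            rw [if_pos h1, edgeMass_lindenstraussWeight hp0 hd h0, h1]
      _ = 1 := ENNReal.mul_inv_cancel (by exact_mod_cast hdk) (ENNReal.natCast_ne_top _)
  par_lt := lindenstraussParent_lt hd
  weight_zero := by rw [lindenstraussWeight, if_pos rfl]
  depth_zero := by rw [rootDepth, dif_pos rfl]
  depth_succ j hj := by rw [rootDepth, dif_neg hj]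
  finite_children k := by
    refine (Set.finite_Iio (lindenstraussSigma d (k + 1))).subset ?_
    intro c hc
    by_cases h0 : c = 0
    · rw [h0, Set.mem_Iio]
      exact (Nat.zero_le _).trans_lt (lt_lindenstraussSigma hd _)
    · exact ((lindenstraussParent_eq_iff hd h0).1 hc).2
  exists_child k := by
    have h0 : lindenstraussSigma d k ≠ 0 :=
      ((Nat.zero_le k).trans_lt (lt_lindenstraussSigma hd k)).ne'
    exact ⟨lindenstraussSigma d k, h0, (lindenstraussParent_eq_iff hd h0).2
      ⟨le_rfl, lindenstraussSigma_strictMono hd (Nat.lt_succ_self k)⟩⟩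

/-- The generators are the forest vectors of the tree in which the children of `k` form the block
from `σ(k)` to `σ(k+1) - 1`: there are `d k ≥ 2` of them, each of mass `1 / d k`. -/
lemma ellpCoe_lindenstraussVec (𝕜 : Type*) [RCLike 𝕜] (p : ℝ) (hd : ∀ n, 2 ≤ d n) (k : ℕ) :
    ellpCoe 𝕜 p (lindenstraussVec 𝕜 p d k) =
      differ 𝕜 (lindenstraussParent d) (lindenstraussWeight p d) (Pi.single k 1) := by
  ext j
  have h1 : ellpCoe 𝕜 p (∑ j ∈ Finset.Ico (lindenstraussSigma d k)
      (lindenstraussSigma d (k + 1)), ellpUnit 𝕜 p j) j =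
      if j ∈ Finset.Ico (lindenstraussSigma d k) (lindenstraussSigma d (k + 1)) then 1 else 0 := by
    simp only [map_sum, ellpCoe_unit, Finset.sum_apply, Pi.single_apply, Finset.sum_ite_eq]
  rw [lindenstraussVec, map_sub, map_smul, Pi.sub_apply, Pi.smul_apply, h1, ellpCoe_unit,
    differ_apply, smul_eq_mul]
  simp only [Finset.mem_Ico]
  congr 1
  by_cases hj : j = 0
  · subst hj
    have := lt_lindenstraussSigma hd k
    rw [if_neg (by omega), lindenstraussWeight, if_pos rfl]
    simp
  · by_cases hk : lindenstraussParent d j = k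
    · rw [if_pos ((lindenstraussParent_eq_iff hd hj).1 hk), lindenstraussWeight, if_neg hj, hk]
      simp
    · rw [if_neg fun h => hk ((lindenstraussParent_eq_iff hd hj).2 h)]
      simp [hk]

end Tree

section Space

variable {𝕜 : Type*} [RCLike 𝕜] {p : ℝ}

lemma isQuasiNormClosed_closedSpan {Y : Type*} [AddCommGroup Y] [Module 𝕜 Y] [Norm Y]
    (s : Set Y) : IsQuasiNormClosed (closedSpan 𝕜 s) := by
  intro x hx
  rw [closedSpan, Submodule.mem_sInf]
  intro V hV
  refine hV.2 x fun ε hε => ?_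
  obtain ⟨y, hy, hxy⟩ := hx ε hε
  rw [closedSpan, Submodule.mem_sInf] at hy
  exact ⟨y, hy V hV, hxy⟩

/-- The vectors `x_k` as elements of the space that they generate. -/
noncomputable def lindenstraussBasisVec (𝕜 : Type*) [RCLike 𝕜] (p : ℝ) (d : ℕ → ℕ) (k : ℕ) :
    LindenstraussSpace 𝕜 p d :=
  ⟨lindenstraussVec 𝕜 p d k, subset_closedSpan _ ⟨k, rfl⟩⟩

/-- The closed span inside the subspace agrees with the one in `ℓ_p`: since `𝕏_p(δ)` is closed,
closed subspaces of it remain closed in `ℓ_p`. -/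
lemma closedSpan_lindenstraussBasisVec (d : ℕ → ℕ) :
    closedSpan 𝕜 (Set.range (lindenstraussBasisVec 𝕜 p d)) = ⊤ := by
  rw [eq_top_iff]
  refine le_sInf fun V hV => ?_
  have hclosed : IsQuasiNormClosed (V.map (LindenstraussSpace 𝕜 p d).subtype) := by
    intro x hx
    have hxX : x ∈ LindenstraussSpace 𝕜 p d := by
      refine isQuasiNormClosed_closedSpan _ x fun ε hε => ?_
      obtain ⟨_, ⟨y, -, rfl⟩, hxy⟩ := hx ε hε
      exact ⟨y, y.2, hxy⟩
    refine ⟨⟨x, hxX⟩, hV.2 _ fun ε hε => ?_, rfl⟩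
    obtain ⟨_, ⟨y, hy, rfl⟩, hxy⟩ := hx ε hε
    exact ⟨y, hy, hxy⟩
  have hle : LindenstraussSpace 𝕜 p d ≤ V.map (LindenstraussSpace 𝕜 p d).subtype := by
    refine sInf_le ⟨?_, hclosed⟩
    rintro _ ⟨k, rfl⟩
    exact ⟨lindenstraussBasisVec 𝕜 p d k, hV.1 ⟨k, rfl⟩, rfl⟩
  intro x _
  obtain ⟨y, hy, hyx⟩ := hle x.2
  rwa [← Subtype.ext hyx]

end Space

/-- An element is represented by first recovering its coefficients in the original tree and then
differencing along the mixed one. The equivalence constant `2` comes from `pSum_mix`. -/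
theorem lindenstraussSpace_hasAlmostGreedyBasisWithGrowth (𝕜 : Type*) [RCLike 𝕜] {p : ℝ}
    (hp0 : 0 < p) (hp1 : p ≤ 1) {d : ℕ → ℕ} (hd : ∀ n, 2 ≤ d n) {a : ℝ} (ha0 : 0 < a)
    (ha1 : a ≤ 1 / p) :
    HasAlmostGreedyBasisWithGrowth 𝕜 (LindenstraussSpace 𝕜 p d) a := by
  obtain ⟨e, he, he2, hup, hlow⟩ := exists_branching_exponents (r := a * p) (by positivity)
    ((le_div_iff₀ hp0).1 ha1)
  have he1 : ∀ i, 1 ≤ e i := fun i => one_le_two.trans (he2 i)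
  have T := isRootedTree_lindenstrauss hp0 hd
  set dep := rootDepth (lindenstraussParent_lt hd)
  obtain ⟨E, hE1, hE2⟩ := exists_partialEquiv_treeNodes e (T.infinite_compl_coarseNodes he2)
  have D : GlueData p e (coarseNodes e dep) (mixParent T.par_lt (coarseNodes e dep))
      (mixWeight T.par_lt (coarseNodes e dep) (lindenstraussWeight p d))
      (fun j => levelCount e (dep j)) E :=
    { T.isPartialForest hp0 he1 with
      one_le := he1
      source_eq := hE1
      target_eq := hE2 }
  set ι : LindenstraussSpace 𝕜 p d →ₗ[𝕜] (ℕ → 𝕜) :=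
    ellpCoe 𝕜 p ∘ₗ (LindenstraussSpace 𝕜 p d).subtype with hι
  set J := integ 𝕜 (lindenstraussParent d) (lindenstraussWeight p d) dep with hJ
  set M := differ 𝕜 (mixParent T.par_lt (coarseNodes e dep))
      (mixWeight T.par_lt (coarseNodes e dep) (lindenstraussWeight p d)) with hM
  have hιnorm : ∀ f, pSum p (ι f) = ENNReal.ofReal (‖f‖ ^ p) := fun f => pSum_ellpCoe hp0 _
  have hmix : ∀ f, pSum p (M (J (ι f))) ≤ 2 * pSum p (ι f) ∧
      pSum p (ι f) ≤ 2 * pSum p (M (J (ι f))) := by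
    intro f
    have := T.pSum_mix (S := coarseNodes e dep) hp0 hp1 (J (ι f))
    rwa [hJ, differ_integ T.isDepth] at this
  have hGu : ∀ k, (M ∘ₗ J ∘ₗ ι) (lindenstraussBasisVec 𝕜 p d k) = M (Pi.single k 1) := by
    intro k
    have h1 : ι (lindenstraussBasisVec 𝕜 p d k) =
        differ 𝕜 (lindenstraussParent d) (lindenstraussWeight p d) (Pi.single k 1) :=
      ellpCoe_lindenstraussVec 𝕜 p hd k
    rw [LinearMap.comp_apply, LinearMap.comp_apply, h1, hJ, integ_differ T.isDepth]
  refine D.hasAlmostGreedyBasisWithGrowth hp0 hp1 he hup hlow (M ∘ₗ J ∘ₗ ι) two_pos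
    (fun f => ellp_norm_nonneg _) ?_ (fun f => ?_) (fun f => ?_) (lindenstraussBasisVec 𝕜 p d)
    (closedSpan_lindenstraussBasisVec d) ?_
  · rw [← LinearMap.ker_eq_bot, LinearMap.ker_eq_bot']
    intro f hf
    have h1 := (hmix f).2
    rw [LinearMap.comp_apply, LinearMap.comp_apply] at hf
    rw [hf] at h1
    have h2 : pSum p (ι f) = 0 := by
      refine le_antisymm (h1.trans ?_) zero_le
      simp [pSum, hp0]
    exact Subtype.ext (ellpCoe_injective ((eq_zero_of_pSum_eq_zero hp0 h2).trans
      (map_zero (ellpCoe 𝕜 p)).symm))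
  · refine (hmix f).1.trans (le_of_eq ?_)
    rw [hιnorm, ENNReal.ofReal_mul (by norm_num)]
    simp
  · rw [← hιnorm]
    refine (hmix f).2.trans (le_of_eq ?_)
    simp
  · simp only [hGu]
    exact T.span_differ_mix 𝕜 he1

/-! ### Permutative equivalence and a continuum of bases. -/

namespace MBasis

variable {𝕜 Y Z : Type*} [RCLike 𝕜] [AddCommGroup Y] [Module 𝕜 Y] [Norm Y]
  [AddCommGroup Z] [Module 𝕜 Z] [Norm Z]

/-- A bounded functional that vanishes on the vectors of a basis is zero. -/
lemma eq_zero_of_vec (B : MBasis 𝕜 Y) (φ : Y →ₗ[𝕜] 𝕜) {C : ℝ} (hC : 0 ≤ C)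
    (hφ : ∀ f, ‖φ f‖ ≤ C * ‖f‖) (hvec : ∀ n, φ (B.vec n) = 0) (f : Y) : φ f = 0 := by
  have hle : closedSpan 𝕜 (Set.range B.vec) ≤ LinearMap.ker φ := by
    refine sInf_le ⟨?_, fun x hx => ?_⟩
    · rintro _ ⟨n, rfl⟩
      exact hvec n
    · rw [LinearMap.mem_ker, ← norm_le_zero_iff]
      refine le_of_forall_pos_le_add fun ε hε => ?_
      obtain ⟨y, hy, hxy⟩ := hx (ε / (C + 1)) (by positivity)
      have h1 : φ x = φ (x - y) := by rw [map_sub, LinearMap.mem_ker.1 hy, sub_zero]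
      rw [h1, zero_add]
      refine (hφ _).trans ?_
      calc C * ‖x - y‖ ≤ C * (ε / (C + 1)) := by gcongr
        _ ≤ (C + 1) * (ε / (C + 1)) := by gcongr; linarith
        _ = ε := by field_simp
  rw [B.fundamental] at hle
  exact hle Submodule.mem_top

lemma PermEquivalent.symm {B : MBasis 𝕜 Y} {B' : MBasis 𝕜 Z} (h : B.PermEquivalent B') :
    B'.PermEquivalent B := by
  obtain ⟨π, T, ⟨C, hC⟩, hT⟩ := h
  refine ⟨π.symm, T.symm, ⟨C, fun f => ?_⟩, fun j => ?_⟩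
  · have := hC (T.symm f)
    rw [T.apply_symm_apply] at this
    exact ⟨this.2, this.1⟩
  · rw [LinearEquiv.symm_apply_eq, ← hT, Equiv.apply_symm_apply]

lemma PermEquivalent.refl (B : MBasis 𝕜 Y) : B.PermEquivalent B :=
  ⟨Equiv.refl ℕ, LinearEquiv.refl 𝕜 Y, ⟨1, fun f => by simp⟩, fun j => rfl⟩

/-- Permutative equivalence transports the bounds for the coordinate projections. -/
lemma PermEquivalent.exists_bound {B : MBasis 𝕜 Y} {B' : MBasis 𝕜 Z} (hY : ∀ f : Y, 0 ≤ ‖f‖)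
    (hZ : ∀ f : Z, 0 ≤ ‖f‖) (h : B.PermEquivalent B') :
    ∃ K : ℝ, 0 < K ∧ ∀ (m : ℕ) (D : ℝ), 0 ≤ D →
      (∀ A : Finset ℕ, A.card ≤ m → ∀ f : Y, ‖B.proj A f‖ ≤ D * ‖f‖) →
      ∀ A : Finset ℕ, A.card ≤ m → ∀ f : Z, ‖B'.proj A f‖ ≤ K * D * ‖f‖ := by
  obtain ⟨π, T, ⟨C₀, hC₀⟩, hT⟩ := h
  obtain ⟨C, hCpos, hC⟩ : ∃ C : ℝ, 0 < C ∧ ∀ f : Y, ‖T f‖ ≤ C * ‖f‖ ∧ ‖f‖ ≤ C * ‖T f‖ := by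
    refine ⟨max C₀ 1, by positivity, fun f => ⟨(hC₀ f).1.trans ?_, (hC₀ f).2.trans ?_⟩⟩
    · exact mul_le_mul_of_nonneg_right (le_max_left _ _) (hY f)
    · exact mul_le_mul_of_nonneg_right (le_max_left _ _) (hZ _)
  -- Both sides are bounded functionals that agree on the vectors `B.vec n`, whose closed span is
  -- everything.
  have hcoord : ∀ j f, B'.coord j (T f) = B.coord (π j) f := by
    intro j f
    obtain ⟨C₁, hC₁⟩ := B.norm_coord
    obtain ⟨C₂, hC₂⟩ := B'.norm_coord
    have h1 := B.eq_zero_of_vec (B'.coord j ∘ₗ T.toLinearMap - B.coord (π j))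
      (C := |C₂| * C + |C₁|) (by positivity) (fun g => by
        rw [LinearMap.sub_apply, LinearMap.comp_apply]
        refine (norm_sub_le _ _).trans ?_
        rw [add_mul]
        refine add_le_add ((hC₂ j _).trans ?_) ((hC₁ _ g).trans ?_)
        · calc C₂ * ‖T g‖ ≤ |C₂| * ‖T g‖ :=
                mul_le_mul_of_nonneg_right (le_abs_self _) (hZ _)
            _ ≤ |C₂| * (C * ‖g‖) := mul_le_mul_of_nonneg_left (hC g).1 (abs_nonneg _)
            _ = |C₂| * C * ‖g‖ := by ring
        · exact mul_le_mul_of_nonneg_right (le_abs_self _) (hY _)) (fun n => by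
        rw [LinearMap.sub_apply, LinearMap.comp_apply]
        have h2 : T (B.vec n) = B'.vec (π.symm n) := by rw [← hT, Equiv.apply_symm_apply]
        rw [LinearEquiv.coe_coe, h2, B.biorthogonal, B'.biorthogonal, sub_eq_zero]
        congr 1
        rw [eq_iff_iff, ← Equiv.eq_symm_apply]) f
    rw [LinearMap.sub_apply, sub_eq_zero] at h1
    exact h1
  refine ⟨C * C, by positivity, fun m D hD hA A hAm f => ?_⟩
  obtain ⟨g, rfl⟩ := T.surjective f
  have h1 : B'.proj A (T g) = T (B.proj (A.map π.toEmbedding) g) := by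
    rw [MBasis.proj, MBasis.proj, Finset.sum_map, _root_.map_sum]
    refine Finset.sum_congr rfl fun j _ => ?_
    rw [map_smul, hcoord, Equiv.coe_toEmbedding, hT]
  rw [h1]
  calc ‖T (B.proj (A.map π.toEmbedding) g)‖ ≤ C * ‖B.proj (A.map π.toEmbedding) g‖ := (hC _).1
    _ ≤ C * (D * ‖g‖) := by
        gcongr
        exact hA _ (by rwa [Finset.card_map]) g
    _ ≤ C * (D * (C * ‖T g‖)) := by
        gcongr
        exact (hC g).2
    _ = C * C * D * ‖T g‖ := by ring

/-- Equivalence preserves the order of the conditionality constants, and `(log m)^(b - a)` is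
unbounded when `b > a`. -/
lemma PermEquivalent.growth_le {B : MBasis 𝕜 Y} {B' : MBasis 𝕜 Z} (hY : ∀ f : Y, 0 ≤ ‖f‖)
    (hZ : ∀ f : Z, 0 ≤ ‖f‖) (h : B.PermEquivalent B') {a b c C c' : ℝ} (hc : 0 < c) (hc' : 0 < c')
    (hB : ∀ m : ℕ, 2 ≤ m → c * Real.log m ^ a ≤ B.conditionalityConst m ∧
      B.conditionalityConst m ≤ C * Real.log m ^ a)
    (hB' : ∀ m : ℕ, 2 ≤ m → c' * Real.log m ^ b ≤ B'.conditionalityConst m) : b ≤ a := by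
  obtain ⟨K, hK, hbound⟩ := h.exists_bound hY hZ
  have hlog : ∀ m : ℕ, 2 ≤ m → 0 < Real.log m := fun m hm =>
    Real.log_pos (by exact_mod_cast hm)
  have hkey : ∀ m : ℕ, 2 ≤ m → c' * Real.log m ^ b ≤ K * (C * Real.log m ^ a) := by
    intro m hm
    have hlm := hlog m hm
    have hpos : 0 < B.conditionalityConst m :=
      lt_of_lt_of_le (by positivity) (hB m hm).1
    -- The infimum of the empty set is `0` by convention, so the positive lower bound shows that
    -- some admissible constant exists.
    have hne : {D : ℝ | 0 ≤ D ∧ ∀ A : Finset ℕ, A.card ≤ m →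
        ∀ f : Y, ‖B.proj A f‖ ≤ D * ‖f‖}.Nonempty := by
      by_contra hcon
      rw [Set.not_nonempty_iff_eq_empty] at hcon
      rw [conditionalityConst, hcon, Real.sInf_empty] at hpos
      exact lt_irrefl _ hpos
    have h1 : B'.conditionalityConst m / K ≤ B.conditionalityConst m := by
      refine le_csInf hne ?_
      rintro D ⟨hD, hA⟩
      rw [div_le_iff₀ hK, mul_comm]
      exact csInf_le ⟨0, fun x hx => hx.1⟩ ⟨by positivity, hbound m D hD hA⟩
    rw [div_le_iff₀ hK] at h1
    calc c' * Real.log m ^ b ≤ B'.conditionalityConst m := hB' m hm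
      _ ≤ B.conditionalityConst m * K := h1
      _ ≤ (C * Real.log m ^ a) * K := by
          gcongr
          exact (hB m hm).2
      _ = K * (C * Real.log m ^ a) := mul_comm _ _
  by_contra hab
  push Not at hab
  have hlim : Filter.Tendsto (fun m : ℕ => Real.log m ^ (b - a)) Filter.atTop Filter.atTop :=
    (tendsto_rpow_atTop (sub_pos.2 hab)).comp
      (Real.tendsto_log_atTop.comp tendsto_natCast_atTop_atTop)
  obtain ⟨m, hm1, hm2⟩ := ((hlim.eventually_gt_atTop (K * C / c')).and
    (Filter.eventually_ge_atTop 2)).exists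
  have hlm := hlog m hm2
  have h1 := hkey m hm2
  rw [Real.rpow_sub hlm, div_lt_div_iff₀ hc' (by positivity)] at hm1
  linarith

end MBasis

/-- A space with bases of all the growth rates `(log m) ^ a`, `0 < a ≤ 1 / p`, has a continuum of
them, which are pairwise not permutatively equivalent. -/
theorem exists_continuum_of_growth {𝕜 Y : Type*} [RCLike 𝕜] [AddCommGroup Y] [Module 𝕜 Y] [Norm Y]
    (hY : ∀ f : Y, 0 ≤ ‖f‖) {p : ℝ} (hp0 : 0 < p)
    (h : ∀ a : ℝ, 0 < a → a ≤ 1 / p → HasAlmostGreedyBasisWithGrowth 𝕜 Y a) :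
    ∃ 𝓑 : Set (MBasis 𝕜 Y),
      Cardinal.mk 𝓑 = Cardinal.continuum ∧
      (∀ B ∈ 𝓑, B.IsAlmostGreedy) ∧
      (∀ B ∈ 𝓑, ∀ B' ∈ 𝓑, B ≠ B' → ¬ B.PermEquivalent B') ∧
      (∀ a : ℝ, 0 < a → a ≤ 1 / p → ∃ B ∈ 𝓑, ∃ c C : ℝ, 0 < c ∧ 0 < C ∧
        ∀ m : ℕ, 2 ≤ m →
          c * Real.log m ^ a ≤ B.conditionalityConst m ∧
          B.conditionalityConst m ≤ C * Real.log m ^ a) := by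
  choose B hB c C hc hC hbd using fun a : Set.Ioc (0 : ℝ) (1 / p) => h a a.2.1 a.2.2
  have hinj : ∀ a b, (B a).PermEquivalent (B b) → a = b := by
    intro a b hab
    apply Subtype.ext
    apply le_antisymm
    · exact hab.symm.growth_le hY hY (hc b) (hc a) (hbd b) fun m hm => (hbd a m hm).1
    · exact hab.growth_le hY hY (hc a) (hc b) (hbd a) fun m hm => (hbd b m hm).1
  have hBinj : Function.Injective B := fun a b hab =>
    hinj a b (by rw [hab]; exact MBasis.PermEquivalent.refl _)
  refine ⟨Set.range B, ?_, ?_, ?_, ?_⟩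
  -- The index set `(0, 1/p]` has the cardinality of the continuum; the lifts reconcile its universe
  -- with that of the bases.
  · have h1 := Cardinal.mk_range_eq_of_injective hBinj
    rw [Cardinal.mk_Ioc_real (by positivity), Cardinal.lift_continuum] at h1
    rw [← Cardinal.lift_inj, h1, Cardinal.lift_continuum]
  · rintro _ ⟨a, rfl⟩
    exact hB a
  · rintro _ ⟨a, rfl⟩ _ ⟨b, rfl⟩ hne hab
    exact hne (by rw [hinj a b hab])
  · intro a ha0 ha1
    exact ⟨B ⟨a, ha0, ha1⟩, ⟨_, rfl⟩, c ⟨a, ha0, ha1⟩, C ⟨a, ha0, ha1⟩, hc _, hC _, hbd _⟩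

theorem mainTheorem4 (𝕜 : Type*) [RCLike 𝕜] (p : ℝ) (hp0 : 0 < p) (hp1 : p ≤ 1) :
    (∀ d : ℕ → ℕ, (∀ n, 2 ≤ d n) →
      ∃ 𝓑 : Set (MBasis 𝕜 (LindenstraussSpace 𝕜 p d)),
        Cardinal.mk 𝓑 = Cardinal.continuum ∧
        (∀ B ∈ 𝓑, B.IsAlmostGreedy) ∧
        (∀ B ∈ 𝓑, ∀ B' ∈ 𝓑, B ≠ B' → ¬ B.PermEquivalent B') ∧
        (∀ a : ℝ, 0 < a → a ≤ 1 / p → ∃ B ∈ 𝓑, ∃ c C : ℝ, 0 < c ∧ 0 < C ∧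
          ∀ m : ℕ, 2 ≤ m →
            c * Real.log m ^ a ≤ B.conditionalityConst m ∧
            B.conditionalityConst m ≤ C * Real.log m ^ a)) ∧
    (∃ 𝓑 : Set (MBasis 𝕜 (EllP 𝕜 p)),
        Cardinal.mk 𝓑 = Cardinal.continuum ∧
        (∀ B ∈ 𝓑, B.IsAlmostGreedy) ∧
        (∀ B ∈ 𝓑, ∀ B' ∈ 𝓑, B ≠ B' → ¬ B.PermEquivalent B') ∧
        (∀ a : ℝ, 0 < a → a ≤ 1 / p → ∃ B ∈ 𝓑, ∃ c C : ℝ, 0 < c ∧ 0 < C ∧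
          ∀ m : ℕ, 2 ≤ m →
            c * Real.log m ^ a ≤ B.conditionalityConst m ∧
            B.conditionalityConst m ≤ C * Real.log m ^ a)) := by
  refine ⟨fun d hd => exists_continuum_of_growth (Y := LindenstraussSpace 𝕜 p d)
      (fun f => ellp_norm_nonneg _) hp0
      fun a ha0 ha1 => lindenstraussSpace_hasAlmostGreedyBasisWithGrowth 𝕜 hp0 hp1 hd ha0 ha1,
    exists_continuum_of_growth ellp_norm_nonneg hp0
      fun a ha0 ha1 => ellp_hasAlmostGreedyBasisWithGrowth 𝕜 hp0 hp1 ha0 ha1⟩
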